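/- An \emph{ultragraph} $\mathcal G=(G^0,\mathcal G^1,r,s)$ consists of countable sets $G^0$ (vertices) and $\mathcal G^1$ (edges) and maps $s:\mathcal G^1\to G^0$ and $r:\mathcal G^1\to\mathcal P(G^0)\setminus\{\varnothing\}$. Let $\mathcal G^0\subseteq\mathcal P(G^0)$ be the smallest family containing $\varnothing$, all $\{v\}$ ($v\in G^0$) and all $r(e)$ ($e\in\mathcal G^1$) and closed under relative complements, finite unions and finite intersections. A vertex $v$ is \emph{regular} if $0<|s^{-1}(v)|<\infty$. For a field $K$, the \emph{Leavitt path algebra} $L_K(\mathcal G)$ is the (not necessarily unital) $K$-algebra generated by $\{p_A\mid A\in\mathcal G^0\}\cup\{s_e,s_e^*\mid e\in\mathcal G^1\}$ subject to the relations, for all $A,B\in\mathcal G^0$ and $e,f\in\mathcal G^1$: (1) $p_\varnothing=0$, $p_Ap_B=p_{A\cap B}$, $p_{A\cup B}=p_A+p_B-p_{A\cap B}$; (2) $p_{\{s(e)\}}s_e=s_e=s_ep_{r(e)}$ and $p_{r(e)}s_e^*=s_e^*=s_e^*p_{\{s(e)\}}$; (3) $s_e^*s_f=\delta_{e,f}\,p_{r(e)}$;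 (4) $p_{\{v\}}=\sum_{s(e)=v}s_es_e^*$ for every regular vertex $v$. A subset $\mathcal H\subseteq\mathcal G^0$ is \emph{hereditary} if (i) $\{s(e)\}\in\mathcal H$ implies $r(e)\in\mathcal H$ for every edge $e$; (ii) $A\cup B\in\mathcal H$ for all $A,B\in\mathcal H$; (iii) $A\in\mathcal H$, $B\in\mathcal G^0$ and $B\subseteq A$ imply $B\in\mathcal H$. It is \emph{saturated} if, for every regular vertex $v$, $\{r(e)\mid e\in\mathcal G^1,\ s(e)=v\}\subseteq\mathcal H$ implies $\{v\}\in\mathcal H$. For a directed graph $E$ (with arbitrary sets of vertices and edges) and a field $F$, the Leavitt path algebra $L_F(E)$ is the (not necessarily unital) $F$-algebra generated by the vertices $v$, the edges $e$ and the ghost edges $e^*$ subject to: $vw=\delta_{v,w}v$; $s(e)e=e=e\,r(e)$ and $r(e)e^*=e^*=e^*s(e)$; $e^*f=\delta_{e,f}\,r(e)$; and $v=\sum_{s(e)=v}ee^*$ for every vertex $v$ that emits at least one and only finitely many edges. \textbf{Proposition.} Let $K$ be a field and let $\mathcal G$ be an ultragraph such that $L_K(\mathcal G)$ is unital and such that there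 are infinitely many hereditary saturated subsets of $\mathcal G^0$. Then $L_K(\mathcal G)$ is not isomorphic to any graph Leavitt path algebra: for every field $F$ and every directed graph $E$, the rings $L_K(\mathcal G)$ and $L_F(E)$ are not isomorphic. In particular, $L_K(\mathcal G)$ and $L_K(E)$ are not isomorphic as $K$-algebras for any directed graph $E$. -/

import Mathlib

/-! ### Non-unital algebras given by generators and relations -/

/-- The (not necessarily unital) associative `K`-algebra with generators `X` and relations `rel`,
where the relations are identities between non-commutative polynomials without constant term.
It is realised inside the unital algebra with the same presentation (its unitization), as the
non-unital subalgebra generated by the images of the generators. -/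
def PresentedAlgebra (K : Type*) [Field K] {X : Type*}
    (rel : FreeAlgebra K X → FreeAlgebra K X → Prop) : NonUnitalSubalgebra K (RingQuot rel) :=
  NonUnitalAlgebra.adjoin K
    (Set.range fun x : X => RingQuot.mkAlgHom K rel (FreeAlgebra.ι K x))

namespace PresentedAlgebra

/-- The image of a generator in the presented algebra. -/
def of (K : Type*) [Field K] {X : Type*} (rel : FreeAlgebra K X → FreeAlgebra K X → Prop)
    (x : X) : PresentedAlgebra K rel :=
  ⟨RingQuot.mkAlgHom K rel (FreeAlgebra.ι K x), NonUnitalAlgebra.subset_adjoin K ⟨x, rfl⟩⟩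

/-- The universal property: a family `f` in a non-unital `K`-algebra `A` that satisfies the
relations (evaluated in the unitization of `A`) extends uniquely to a homomorphism of
non-unital `K`-algebras. -/
theorem existsUnique_lift {K : Type*} [Field K] {X : Type*}
    (rel : FreeAlgebra K X → FreeAlgebra K X → Prop)
    {A : Type*} [NonUnitalRing A] [Module K A] [IsScalarTower K A A] [SMulCommClass K A A]
    (f : X → A)
    (hf : ∀ a b, rel a b →
      FreeAlgebra.lift K (fun x => (f x : Unitization K A)) a =
        FreeAlgebra.lift K (fun x => (f x : Unitization K A)) b) :
    ∃! φ : PresentedAlgebra K rel →ₙₐ[K] A, ∀ x, φ (of K rel x) = f x := by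
  let Φ : RingQuot rel →ₐ[K] Unitization K A := RingQuot.liftAlgHom K ⟨_, fun {a b} => hf a b⟩
  have hΦ : ∀ x, Φ (RingQuot.mkAlgHom K rel (FreeAlgebra.ι K x)) = (f x : Unitization K A) := by
    intro x
    simp [Φ]
  have hle : PresentedAlgebra K rel ≤
      (NonUnitalAlgHom.range (Unitization.inrNonUnitalAlgHom K A)).comap
        (Φ : RingQuot rel →ₙₐ[K] Unitization K A) := by
    refine NonUnitalAlgebra.adjoin_le ?_
    rintro _ ⟨x, rfl⟩
    exact ⟨f x, (hΦ x).symm⟩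
  have hsnd : ∀ y : PresentedAlgebra K rel,
      ((Φ (y : RingQuot rel)).snd : Unitization K A) = Φ (y : RingQuot rel) := by
    rintro ⟨y, hy⟩
    obtain ⟨a, ha⟩ := hle hy
    have ha' : (a : Unitization K A) = Φ y := ha
    simp [← ha']
  refine ⟨{ toFun := fun y => (Φ (y : RingQuot rel)).snd
            map_smul' := fun c y => by simp
            map_zero' := by simp
            map_add' := fun y z => by simp
            map_mul' := fun y z => ?_ }, ?_, ?_⟩
  · apply Unitization.inr_injective (R := K)
    rw [Unitization.inr_mul, hsnd, hsnd, hsnd]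
    simp
  · intro x
    change (Φ (RingQuot.mkAlgHom K rel (FreeAlgebra.ι K x))).snd = f x
    rw [hΦ]
    simp
  · intro ψ hψ
    have key : ∀ (y : RingQuot rel) (hy : y ∈ PresentedAlgebra K rel),
        (ψ ⟨y, hy⟩ : A) = (Φ y).snd := by
      intro y hy
      refine NonUnitalAlgebra.adjoin_induction
        (p := fun y hy => ψ (⟨y, hy⟩ : PresentedAlgebra K rel) = (Φ y).snd) ?_ ?_ ?_ ?_ ?_ hy
      · rintro _ ⟨x, rfl⟩
        rw [hΦ]
        exact (hψ x).trans (by simp)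
      · intro y z hy hz h1 h2
        have : (⟨y + z, add_mem hy hz⟩ : PresentedAlgebra K rel) = ⟨y, hy⟩ + ⟨z, hz⟩ := rfl
        rw [this, map_add, h1, h2]
        simp
      · have : (⟨0, zero_mem _⟩ : PresentedAlgebra K rel) = 0 := rfl
        rw [this, map_zero]
        simp
      · intro y z hy hz h1 h2
        have : (⟨y * z, mul_mem hy hz⟩ : PresentedAlgebra K rel) = ⟨y, hy⟩ * ⟨z, hz⟩ := rfl
        rw [this, map_mul, h1, h2]
        apply Unitization.inr_injective (R := K)
        rw [Unitization.inr_mul, hsnd ⟨y, hy⟩, hsnd ⟨z, hz⟩, hsnd ⟨y * z, mul_mem hy hz⟩]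
        simp
      · intro c y hy h1
        have : (⟨c • y, SMulMemClass.smul_mem c hy⟩ : PresentedAlgebra K rel) = c • ⟨y, hy⟩ := rfl
        rw [this, map_smul, h1]
        simp
    ext ⟨y, hy⟩
    exact key y hy

end PresentedAlgebra

/-! ### Ultragraphs -/

/-- An ultragraph with vertex set `V` and edge set `E`: every edge has a source vertex and a
nonempty set of vertices as its range. (Countability of `V` and `E` is assumed separately.) -/
structure Ultragraph (V E : Type*) where
  source : E → V
  range : E → Set V
  range_nonempty : ∀ e, (range e).Nonempty

namespace Ultragraph

variable {V E : Type*} (G : Ultragraph V E)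

/-- The generalized vertices `𝒢⁰`: the smallest family of sets of vertices that contains all
singletons and all ranges of edges and is closed under relative complements, finite unions
(including the empty one) and finite intersections. -/
inductive IsGeneralizedVertex : Set V → Prop
  | empty : IsGeneralizedVertex ∅
  | singleton (v : V) : IsGeneralizedVertex {v}
  | range (e : E) : IsGeneralizedVertex (G.range e)
  | diff {A B : Set V} :
      IsGeneralizedVertex A → IsGeneralizedVertex B → IsGeneralizedVertex (A \ B)
  | union {A B : Set V} :
      IsGeneralizedVertex A → IsGeneralizedVertex B → IsGeneralizedVertex (A ∪ B)
  | inter {A B : Set V} :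
      IsGeneralizedVertex A → IsGeneralizedVertex B → IsGeneralizedVertex (A ∩ B)

/-- The family `𝒢⁰` of all generalized vertices. -/
def generalizedVertices : Set (Set V) := {A | G.IsGeneralizedVertex A}

/-- A vertex is regular if it emits at least one and only finitely many edges. -/
def IsRegular (v : V) : Prop := {e | G.source e = v}.Nonempty ∧ {e | G.source e = v}.Finite

/-- Hereditary subsets of `𝒢⁰`. -/
structure IsHereditary (H : Set (Set V)) : Prop where
  subset : H ⊆ G.generalizedVertices
  range_mem : ∀ e, {G.source e} ∈ H → G.range e ∈ H
  union_mem : ∀ A ∈ H, ∀ B ∈ H, A ∪ B ∈ H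
  mem_of_subset : ∀ A ∈ H, ∀ B ∈ G.generalizedVertices, B ⊆ A → B ∈ H

/-- Saturated subsets of `𝒢⁰`. -/
def IsSaturated (H : Set (Set V)) : Prop :=
  ∀ v, G.IsRegular v → {A | ∃ e, G.source e = v ∧ A = G.range e} ⊆ H → {v} ∈ H

/-- The generators `p_A` (for `A ∈ 𝒢⁰`), `s_e` and `s_e^*` (for edges `e`) of the Leavitt path
algebra of an ultragraph. -/
inductive LeavittGenerator
  | proj (A : Set V) (hA : G.IsGeneralizedVertex A)
  | edge (e : E)
  | ghost (e : E)

section Leavitt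

variable (K : Type*) [Field K]

/-- `p_A` in the free algebra on the generators. -/
def p {A : Set V} (hA : G.IsGeneralizedVertex A) : FreeAlgebra K G.LeavittGenerator :=
  FreeAlgebra.ι K (.proj A hA)

/-- `s_e` in the free algebra on the generators. -/
def s (e : E) : FreeAlgebra K G.LeavittGenerator := FreeAlgebra.ι K (.edge e)

/-- `s_e^*` in the free algebra on the generators. -/
def sStar (e : E) : FreeAlgebra K G.LeavittGenerator := FreeAlgebra.ι K (.ghost e)

/-- The defining relations of the Leavitt path algebra of an ultragraph. -/
inductive LeavittRel :
    FreeAlgebra K G.LeavittGenerator → FreeAlgebra K G.LeavittGenerator → Prop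
  | proj_empty : LeavittRel (G.p K .empty) 0
  | proj_mul {A B : Set V} (hA : G.IsGeneralizedVertex A) (hB : G.IsGeneralizedVertex B) :
      LeavittRel (G.p K hA * G.p K hB) (G.p K (hA.inter hB))
  | proj_union {A B : Set V} (hA : G.IsGeneralizedVertex A) (hB : G.IsGeneralizedVertex B) :
      LeavittRel (G.p K (hA.union hB)) (G.p K hA + G.p K hB - G.p K (hA.inter hB))
  | source_mul_edge (e : E) : LeavittRel (G.p K (.singleton (G.source e)) * G.s K e) (G.s K e)
  | edge_mul_range (e : E) : LeavittRel (G.s K e * G.p K (.range e)) (G.s K e)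
  | range_mul_ghost (e : E) : LeavittRel (G.p K (.range e) * G.sStar K e) (G.sStar K e)
  | ghost_mul_source (e : E) :
      LeavittRel (G.sStar K e * G.p K (.singleton (G.source e))) (G.sStar K e)
  | ghost_mul_edge_self (e : E) : LeavittRel (G.sStar K e * G.s K e) (G.p K (.range e))
  | ghost_mul_edge_of_ne {e f : E} (h : e ≠ f) : LeavittRel (G.sStar K e * G.s K f) 0
  | regular (v : V) (hv : G.IsRegular v) :
      LeavittRel (G.p K (.singleton v)) (∑ e ∈ hv.2.toFinset, G.s K e * G.sStar K e)

/-- The Leavitt path algebra `L_K(𝒢)` of an ultragraph `𝒢`, a not necessarily unital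
`K`-algebra. -/
abbrev LeavittPathAlgebra : NonUnitalSubalgebra K (RingQuot (G.LeavittRel K)) :=
  PresentedAlgebra K (G.LeavittRel K)

end Leavitt

end Ultragraph

/-! ### Leavitt path algebras of directed graphs -/

namespace Quiver

variable (V : Type*) [Quiver V]

/-- A vertex of a directed graph is regular if it emits at least one and only finitely many
edges. Edges are elements `e` of `Quiver.Total V`, with source `e.left` and range `e.right`. -/
def IsRegular (v : V) : Prop :=
  {e : Quiver.Total V | e.left = v}.Nonempty ∧ {e : Quiver.Total V | e.left = v}.Finite

/-- The generators `v` (vertices), `e` and `e^*` (edges) of the Leavitt path algebra of a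
directed graph. -/
inductive LeavittGenerator
  | vertex (v : V)
  | edge (e : Quiver.Total V)
  | ghost (e : Quiver.Total V)

section Leavitt

variable (K : Type*) [Field K]

/-- The vertex `v` in the free algebra on the generators. -/
def p (v : V) : FreeAlgebra K (LeavittGenerator V) := FreeAlgebra.ι K (.vertex v)

/-- The edge `e` in the free algebra on the generators. -/
def s (e : Quiver.Total V) : FreeAlgebra K (LeavittGenerator V) := FreeAlgebra.ι K (.edge e)

/-- The ghost edge `e^*` in the free algebra on the generators. -/
def sStar (e : Quiver.Total V) : FreeAlgebra K (LeavittGenerator V) :=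
  FreeAlgebra.ι K (.ghost e)

/-- The defining relations of the Leavitt path algebra of a directed graph. -/
inductive LeavittRel : FreeAlgebra K (LeavittGenerator V) → FreeAlgebra K (LeavittGenerator V) → Prop
  | vertex_mul_self (v : V) : LeavittRel (p V K v * p V K v) (p V K v)
  | vertex_mul_of_ne {v w : V} (h : v ≠ w) : LeavittRel (p V K v * p V K w) 0
  | source_mul_edge (e : Quiver.Total V) : LeavittRel (p V K e.left * s V K e) (s V K e)
  | edge_mul_range (e : Quiver.Total V) : LeavittRel (s V K e * p V K e.right) (s V K e)
  | range_mul_ghost (e : Quiver.Total V) :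
      LeavittRel (p V K e.right * sStar V K e) (sStar V K e)
  | ghost_mul_source (e : Quiver.Total V) :
      LeavittRel (sStar V K e * p V K e.left) (sStar V K e)
  | ghost_mul_edge_self (e : Quiver.Total V) :
      LeavittRel (sStar V K e * s V K e) (p V K e.right)
  | ghost_mul_edge_of_ne {e f : Quiver.Total V} (h : e ≠ f) :
      LeavittRel (sStar V K e * s V K f) 0
  | regular (v : V) (hv : IsRegular V v) :
      LeavittRel (p V K v) (∑ e ∈ hv.2.toFinset, s V K e * sStar V K e)

/-- The Leavitt path algebra `L_K(E)` of a directed graph `E` (a quiver on the vertex set `V`),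
a not necessarily unital `K`-algebra. -/
abbrev LeavittPathAlgebra : NonUnitalSubalgebra K (RingQuot (LeavittRel V K)) :=
  PresentedAlgebra K (LeavittRel V K)

end Leavitt

end Quiver

/-! The invariant is the number of idempotent two-sided ideals. It depends on the ring structure
alone, so neither the two fields nor linearity of the isomorphism matters.

A unital `L_F(E)` has only finitely many. Its unit involves finitely many monomials, so all but
finitely many vertices vanish in it. An idempotent ideal `I` is graded: apply the coaction `x ↦ x (1
+ X) ^ n` for `x` of degree `n`, whose constant coefficient is `x`. If the coefficients up to `k` of
all elements of `I` are known to lie in `I`, the product formula puts coefficient `k + 1` of every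
product of two elements of `I` in `I`, hence of every element of `I`
(`coeff_coaction_mem_of_isIdempotent`). The homogeneous components are integer combinations of these
coefficients. Homogeneous elements of `I` are controlled by two sets of vertices: those in `I`, and
those `v` with `v (1 - ∑ e e^*)` in `I` for some finite sum (`mem_of_mem_homogeneousSpan`). A finite
vertex set leaves finitely many such pairs.

In `L_K(𝒢)`, the projections `p_A` with `A ∈ H` generate an idempotent ideal. For nonempty
hereditary saturated `H`, this ideal contains no other `p_A` (`leavittProj_mem_leavittIdeal_iff`),
because a branching system built on the ultrafilters that avoid `H` gives a representation that
kills exactly the `p_A` with `A ∈ H`. So infinitely many `H` give infinitely many idempotent ideals.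
-/

/-! ### Idempotent ideals as a ring invariant -/

namespace TwoSidedIdeal

/-- A two-sided ideal is idempotent if it is the smallest two-sided ideal that contains all
products of two of its elements. -/
def IsIdempotent {A : Type*} [NonUnitalNonAssocRing A] (I : TwoSidedIdeal A) : Prop :=
  ∀ J : TwoSidedIdeal A, (∀ y ∈ I, ∀ z ∈ I, y * z ∈ J) → I ≤ J

theorem isIdempotent_span {A : Type*} [NonUnitalNonAssocRing A] {S : Set A}
    (hS : ∀ x ∈ S, x * x = x) : (span S).IsIdempotent := by
  intro J hJ
  rw [span_le]
  intro x hx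
  have := hJ x (subset_span hx) x (subset_span hx)
  rwa [hS x hx] at this

theorem IsIdempotent.comap_symm {A B : Type*} [NonUnitalNonAssocRing A] [NonUnitalNonAssocRing B] (φ : A ≃+* B)
    {I : TwoSidedIdeal A} (hI : I.IsIdempotent) : (I.comap φ.symm).IsIdempotent := by
  intro J hJ x hx
  rw [mem_comap] at hx
  have h : I ≤ J.comap φ := hI _ fun y hy z hz => by
    rw [mem_comap, map_mul]
    exact hJ _ (by simpa [mem_comap] using hy) _ (by simpa [mem_comap] using hz)
  have := h hx
  rw [mem_comap] at this
  simpa using this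

theorem finite_isIdempotent_of_ringEquiv {A B : Type*} [NonUnitalNonAssocRing A] [NonUnitalNonAssocRing B]
    (φ : A ≃+* B) (hB : {I : TwoSidedIdeal B | I.IsIdempotent}.Finite) :
    {I : TwoSidedIdeal A | I.IsIdempotent}.Finite := by
  refine Set.Finite.of_injOn (f := fun I => I.comap φ.symm)
    (fun I hI => IsIdempotent.comap_symm φ hI) ?_ hB
  intro I _ J _ h
  ext x
  have := SetLike.ext_iff.1 h (φ x)
  simpa [mem_comap] using this

end TwoSidedIdeal

/-! ### Monomials and range projections in Cohn families -/

namespace Quiver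

/-- Elements of a ring that satisfy the relations of the Leavitt path algebra of a directed graph
other than the one at regular vertices. -/
structure CohnFamily (W : Type*) [Quiver W] (R : Type*) [Ring R] where
  vertex : W → R
  edge : Quiver.Total W → R
  ghost : Quiver.Total W → R
  vertex_mul_self : ∀ v, vertex v * vertex v = vertex v
  vertex_mul_of_ne : ∀ {v w}, v ≠ w → vertex v * vertex w = 0
  source_mul_edge : ∀ e, vertex e.left * edge e = edge e
  edge_mul_range : ∀ e, edge e * vertex e.right = edge e
  range_mul_ghost : ∀ e, vertex e.right * ghost e = ghost e
  ghost_mul_source : ∀ e, ghost e * vertex e.left = ghost e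
  ghost_mul_edge_self : ∀ e, ghost e * edge e = vertex e.right
  ghost_mul_edge_of_ne : ∀ {e f}, e ≠ f → ghost e * edge f = 0

namespace CohnFamily

variable {W : Type*} [Quiver W] {R : Type*} [Ring R] (c : CohnFamily W R)

theorem vertex_mul_edge_of_ne {v : W} {e : Quiver.Total W} (h : v ≠ e.left) :
    c.vertex v * c.edge e = 0 := by
  rw [← c.source_mul_edge, ← mul_assoc, c.vertex_mul_of_ne h, zero_mul]

theorem ghost_mul_vertex_of_ne {v : W} {e : Quiver.Total W} (h : v ≠ e.left) :
    c.ghost e * c.vertex v = 0 := by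
  rw [← c.ghost_mul_source, mul_assoc, c.vertex_mul_of_ne h.symm, mul_zero]

/-- `c.IsMonomial a b x` holds if `x` is a product of `a` edges, a vertex and `b` ghost edges. -/
inductive IsMonomial : ℕ → ℕ → R → Prop
  | vertex (v : W) : IsMonomial 0 0 (c.vertex v)
  | edge_mul (e : Quiver.Total W) {a b : ℕ} {x : R} :
      IsMonomial a b x → IsMonomial (a + 1) b (c.edge e * x)
  | mul_ghost (e : Quiver.Total W) {a b : ℕ} {x : R} :
      IsMonomial a b x → IsMonomial a (b + 1) (x * c.ghost e)

variable {c}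

/-- Edges attach on the left and ghost edges on the right, so by associativity the order of
attachment is irrelevant and the outermost edge can always be split off. -/
theorem IsMonomial.exists_eq_edge_mul {a b : ℕ} {x : R} (h : c.IsMonomial (a + 1) b x) :
    ∃ e y, c.IsMonomial a b y ∧ x = c.edge e * y := by
  generalize hn : a + 1 = n at h
  induction h with
  | vertex v => omega
  | edge_mul e h _ =>
    cases hn
    exact ⟨e, _, h, rfl⟩
  | mul_ghost e h ih =>
    obtain ⟨f, y, hy, rfl⟩ := ih hn
    exact ⟨f, y * c.ghost e, hy.mul_ghost e, mul_assoc _ _ _⟩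

theorem IsMonomial.exists_eq_mul_ghost {a b : ℕ} {x : R} (h : c.IsMonomial a (b + 1) x) :
    ∃ e y, c.IsMonomial a b y ∧ x = y * c.ghost e := by
  generalize hn : b + 1 = n at h
  induction h with
  | vertex v => omega
  | mul_ghost e h _ =>
    cases hn
    exact ⟨e, _, h, rfl⟩
  | edge_mul e h ih =>
    obtain ⟨f, y, hy, rfl⟩ := ih hn
    exact ⟨f, c.edge e * y, hy.edge_mul e, (mul_assoc _ _ _).symm⟩

theorem IsMonomial.exists_vertex_mul {a b : ℕ} {x : R} (h : c.IsMonomial a b x) :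
    ∃ w, c.vertex w * x = x ∧ ∀ v, v ≠ w → c.vertex v * x = 0 := by
  induction h with
  | vertex w => exact ⟨w, c.vertex_mul_self w, fun v h => c.vertex_mul_of_ne h⟩
  | edge_mul e h _ =>
    refine ⟨e.left, by rw [← mul_assoc, c.source_mul_edge], fun v h => ?_⟩
    rw [← mul_assoc, c.vertex_mul_edge_of_ne h, zero_mul]
  | mul_ghost e h ih =>
    obtain ⟨w, h1, h2⟩ := ih
    exact ⟨w, by rw [← mul_assoc, h1], fun v h => by rw [← mul_assoc, h2 v h, zero_mul]⟩

theorem IsMonomial.exists_mul_vertex {a b : ℕ} {x : R} (h : c.IsMonomial a b x) :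
    ∃ w, x * c.vertex w = x ∧ ∀ v, v ≠ w → x * c.vertex v = 0 := by
  induction h with
  | vertex w => exact ⟨w, c.vertex_mul_self w, fun v h => c.vertex_mul_of_ne h.symm⟩
  | mul_ghost e h _ =>
    refine ⟨e.left, by rw [mul_assoc, c.ghost_mul_source], fun v h => ?_⟩
    rw [mul_assoc, c.ghost_mul_vertex_of_ne h, mul_zero]
  | edge_mul e h ih =>
    obtain ⟨w, h1, h2⟩ := ih
    exact ⟨w, by rw [mul_assoc, h1], fun v h => by rw [mul_assoc, h2 v h, mul_zero]⟩

theorem IsMonomial.vertex_mul {a b : ℕ} {x : R} (h : c.IsMonomial a b x) (v : W) :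
    c.vertex v * x = x ∨ c.vertex v * x = 0 := by
  obtain ⟨w, h1, h2⟩ := h.exists_vertex_mul
  rcases eq_or_ne v w with rfl | hv
  exacts [Or.inl h1, Or.inr (h2 v hv)]

theorem IsMonomial.mul_vertex {a b : ℕ} {x : R} (h : c.IsMonomial a b x) (v : W) :
    x * c.vertex v = x ∨ x * c.vertex v = 0 := by
  obtain ⟨w, h1, h2⟩ := h.exists_mul_vertex
  rcases eq_or_ne v w with rfl | hv
  exacts [Or.inl h1, Or.inr (h2 v hv)]

/-- The ghost edge either cancels the leading edge, leaving a vertex that fixes or kills the rest,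
or annihilates it. -/
theorem IsMonomial.ghost_mul {a b : ℕ} {x : R} (h : c.IsMonomial (a + 1) b x)
    (e : Quiver.Total W) : c.IsMonomial a b (c.ghost e * x) ∨ c.ghost e * x = 0 := by
  obtain ⟨f, y, hy, rfl⟩ := h.exists_eq_edge_mul
  rw [← mul_assoc]
  rcases eq_or_ne e f with rfl | hf
  · rw [c.ghost_mul_edge_self]
    rcases hy.vertex_mul e.right with h | h <;> rw [h]
    exacts [Or.inl hy, Or.inr rfl]
  · rw [c.ghost_mul_edge_of_ne hf, zero_mul]
    exact Or.inr rfl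

theorem IsMonomial.mul_edge {a b : ℕ} {x : R} (h : c.IsMonomial a (b + 1) x)
    (e : Quiver.Total W) : c.IsMonomial a b (x * c.edge e) ∨ x * c.edge e = 0 := by
  obtain ⟨f, y, hy, rfl⟩ := h.exists_eq_mul_ghost
  rw [mul_assoc]
  rcases eq_or_ne f e with rfl | hf
  · rw [c.ghost_mul_edge_self]
    rcases hy.mul_vertex f.right with h | h <;> rw [h]
    exacts [Or.inl hy, Or.inr rfl]
  · rw [c.ghost_mul_edge_of_ne hf, mul_zero]
    exact Or.inr rfl

section RangeProjection

variable (c) in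
/-- The sum of the range projections `e e^*` of finitely many edges. -/
def rangeProjection (Z : Finset (Quiver.Total W)) : R := ∑ e ∈ Z, c.edge e * c.ghost e

theorem rangeProjection_mul (Z : Finset (Quiver.Total W)) (x : R) :
    c.rangeProjection Z * x = ∑ e ∈ Z, c.edge e * (c.ghost e * x) := by
  simp only [rangeProjection, Finset.sum_mul, mul_assoc]

theorem mul_rangeProjection (Z : Finset (Quiver.Total W)) (x : R) :
    x * c.rangeProjection Z = ∑ e ∈ Z, x * c.edge e * c.ghost e := by
  simp only [rangeProjection, Finset.mul_sum, mul_assoc]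

theorem rangeProjection_mul_edge_of_mem {Z : Finset (Quiver.Total W)} {e : Quiver.Total W}
    (he : e ∈ Z) : c.rangeProjection Z * c.edge e = c.edge e := by
  rw [rangeProjection, Finset.sum_mul, Finset.sum_eq_single_of_mem e he]
  · rw [mul_assoc, c.ghost_mul_edge_self, c.edge_mul_range]
  · intro f _ hf
    rw [mul_assoc, c.ghost_mul_edge_of_ne hf, mul_zero]

theorem rangeProjection_mul_edge_of_notMem {Z : Finset (Quiver.Total W)} {e : Quiver.Total W}
    (he : e ∉ Z) : c.rangeProjection Z * c.edge e = 0 := by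
  rw [rangeProjection, Finset.sum_mul]
  refine Finset.sum_eq_zero fun f hf => ?_
  rw [mul_assoc, c.ghost_mul_edge_of_ne (by rintro rfl; exact he hf), mul_zero]

theorem ghost_mul_rangeProjection_of_mem {Z : Finset (Quiver.Total W)} {e : Quiver.Total W}
    (he : e ∈ Z) : c.ghost e * c.rangeProjection Z = c.ghost e := by
  rw [rangeProjection, Finset.mul_sum, Finset.sum_eq_single_of_mem e he]
  · rw [← mul_assoc, c.ghost_mul_edge_self, c.range_mul_ghost]
  · intro f _ hf
    rw [← mul_assoc, c.ghost_mul_edge_of_ne hf.symm, zero_mul]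

theorem rangeProjection_mul_self (Z : Finset (Quiver.Total W)) :
    c.rangeProjection Z * c.rangeProjection Z = c.rangeProjection Z := by
  rw [rangeProjection_mul, rangeProjection]
  exact Finset.sum_congr rfl fun e he => by
    rw [← rangeProjection, ghost_mul_rangeProjection_of_mem he]

theorem commute_vertex_rangeProjection (v : W) (Z : Finset (Quiver.Total W)) :
    Commute (c.vertex v) (c.rangeProjection Z) := by
  refine Commute.sum_right _ _ _ fun e _ => ?_
  rw [Commute, SemiconjBy, ← mul_assoc, mul_assoc (c.edge e)]
  rcases eq_or_ne v e.left with rfl | h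
  · rw [c.source_mul_edge, c.ghost_mul_source]
  · rw [c.vertex_mul_edge_of_ne h, c.ghost_mul_vertex_of_ne h, zero_mul, mul_zero]

end RangeProjection

/-! ### Homogeneous elements of an ideal -/

section Ideals

variable {I J : TwoSidedIdeal R}

/-- Makes the choice of the finite edge set harmless: the two ideals may use different sets, since
the discrepancy consists of edges whose ranges already lie in `I`, hence in `J`. -/
theorem vertex_mul_one_sub_mem (hH : ∀ v, c.vertex v ∈ I → c.vertex v ∈ J) {v : W}
    {Z Z' : Finset (Quiver.Total W)} (hZ : c.vertex v * (1 - c.rangeProjection Z) ∈ I)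
    (hZ' : c.vertex v * (1 - c.rangeProjection Z') ∈ J) :
    c.vertex v * (1 - c.rangeProjection Z) ∈ J := by
  -- Split along `1 = P + (1 - P)` with `P` the projection of `Z'`; the second summand is a multiple
  -- of `hZ'`.
  have h1 : c.vertex v * (1 - c.rangeProjection Z) =
      c.vertex v * (1 - c.rangeProjection Z) * c.rangeProjection Z' +
        (1 - c.rangeProjection Z) * (c.vertex v * (1 - c.rangeProjection Z')) := by
    have : (1 - c.rangeProjection Z) * c.vertex v = c.vertex v * (1 - c.rangeProjection Z) := by
      rw [mul_sub, sub_mul, (commute_vertex_rangeProjection v Z).eq, one_mul, mul_one]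
    rw [← mul_assoc, this]
    noncomm_ring
  rw [h1]
  refine add_mem ?_ (J.mul_mem_left _ _ hZ')
  rw [mul_rangeProjection]
  refine sum_mem fun e _ => ?_
  apply J.mul_mem_right
  rw [mul_assoc, sub_mul, one_mul]
  by_cases he : e ∈ Z
  · rw [rangeProjection_mul_edge_of_mem he, sub_self, mul_zero]
    exact J.zero_mem
  rw [rangeProjection_mul_edge_of_notMem he, sub_zero]
  rcases eq_or_ne v e.left with rfl | hv
  -- For `e ∉ Z` starting at `v`, compressing `hZ` to `e^* (·) e` leaves the range of `e`.
  · have h2 : c.vertex e.right ∈ I := by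
      have := I.mul_mem_left (c.ghost e) _ (I.mul_mem_right _ (c.edge e) hZ)
      rwa [mul_assoc, sub_mul, one_mul, rangeProjection_mul_edge_of_notMem he, sub_zero,
        c.source_mul_edge, c.ghost_mul_edge_self] at this
    rw [c.source_mul_edge, ← c.edge_mul_range]
    exact J.mul_mem_left _ _ (hH _ h2)
  · rw [c.vertex_mul_edge_of_ne hv]
    exact J.zero_mem

variable (F : Type*) [Field F] [Algebra F R]

variable (c) in
/-- The span of the monomials with `k + i` edges and `l + i` ghost edges, where `i ≤ m`. -/
def homogeneousSpan (k l m : ℕ) : Submodule F R :=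
  Submodule.span F {x | ∃ i ≤ m, c.IsMonomial (k + i) (l + i) x}

variable {F}

theorem homogeneousSpan_mono {k l m n : ℕ} (h : m ≤ n) :
    c.homogeneousSpan F k l m ≤ c.homogeneousSpan F k l n :=
  Submodule.span_mono fun _ ⟨i, hi, hx⟩ => ⟨i, hi.trans h, hx⟩

theorem ghost_mul_mem_homogeneousSpan {k l m : ℕ} {x : R} (hx : x ∈ c.homogeneousSpan F (k + 1) l m)
    (e : Quiver.Total W) : c.ghost e * x ∈ c.homogeneousSpan F k l m := by
  induction hx using Submodule.span_induction with
  | mem x hx =>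
    obtain ⟨i, hi, hx⟩ := hx
    rw [add_right_comm] at hx
    rcases hx.ghost_mul e with h | h
    · exact Submodule.subset_span ⟨i, hi, h⟩
    · rw [h]; exact zero_mem _
  | zero => rw [mul_zero]; exact zero_mem _
  | add x y _ _ hx hy => rw [mul_add]; exact add_mem hx hy
  | smul r x _ hx => rw [mul_smul_comm]; exact Submodule.smul_mem _ _ hx

theorem mul_edge_mem_homogeneousSpan {k l m : ℕ} {x : R} (hx : x ∈ c.homogeneousSpan F k (l + 1) m)
    (e : Quiver.Total W) : x * c.edge e ∈ c.homogeneousSpan F k l m := by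
  induction hx using Submodule.span_induction with
  | mem x hx =>
    obtain ⟨i, hi, hx⟩ := hx
    rw [add_right_comm l] at hx
    rcases hx.mul_edge e with h | h
    · exact Submodule.subset_span ⟨i, hi, h⟩
    · rw [h]; exact zero_mem _
  | zero => rw [zero_mul]; exact zero_mem _
  | add x y _ _ hx hy => rw [add_mul]; exact add_mem hx hy
  | smul r x _ hx => rw [smul_mul_assoc]; exact Submodule.smul_mem _ _ hx

/-- The leading edges of the monomials in `x` suffice. Allowing every larger set lets one projection
serve for both sides of an element. -/
theorem exists_rangeProjection_mul {k l m : ℕ} {x : R}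
    (hx : x ∈ c.homogeneousSpan F (k + 1) l m) :
    ∃ Z, ∀ Z', Z ⊆ Z' → c.rangeProjection Z' * x = x := by
  classical
  induction hx using Submodule.span_induction with
  | mem x hx =>
    obtain ⟨i, hi, hx⟩ := hx
    rw [add_right_comm] at hx
    obtain ⟨e, y, -, rfl⟩ := hx.exists_eq_edge_mul
    refine ⟨{e}, fun Z' hZ' => ?_⟩
    rw [← mul_assoc, rangeProjection_mul_edge_of_mem (hZ' (Finset.mem_singleton_self e))]
  | zero => exact ⟨∅, fun _ _ => mul_zero _⟩
  | add x y _ _ hx hy =>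
    obtain ⟨Z, hZ⟩ := hx
    obtain ⟨T, hT⟩ := hy
    refine ⟨Z ∪ T, fun Z' h => ?_⟩
    rw [mul_add, hZ _ (Finset.union_subset_left h), hT _ (Finset.union_subset_right h)]
  | smul r x _ hx =>
    obtain ⟨Z, hZ⟩ := hx
    exact ⟨Z, fun Z' h => by rw [mul_smul_comm, hZ _ h]⟩

theorem exists_mul_rangeProjection {k l m : ℕ} {x : R}
    (hx : x ∈ c.homogeneousSpan F k (l + 1) m) :
    ∃ Z, ∀ Z', Z ⊆ Z' → x * c.rangeProjection Z' = x := by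
  classical
  induction hx using Submodule.span_induction with
  | mem x hx =>
    obtain ⟨i, hi, hx⟩ := hx
    rw [add_right_comm l] at hx
    obtain ⟨e, y, -, rfl⟩ := hx.exists_eq_mul_ghost
    refine ⟨{e}, fun Z' hZ' => ?_⟩
    rw [mul_assoc, ghost_mul_rangeProjection_of_mem (hZ' (Finset.mem_singleton_self e))]
  | zero => exact ⟨∅, fun _ _ => zero_mul _⟩
  | add x y _ _ hx hy =>
    obtain ⟨Z, hZ⟩ := hx
    obtain ⟨T, hT⟩ := hy
    refine ⟨Z ∪ T, fun Z' h => ?_⟩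
    rw [add_mul, hZ _ (Finset.union_subset_left h), hT _ (Finset.union_subset_right h)]
  | smul r x _ hx =>
    obtain ⟨Z, hZ⟩ := hx
    exact ⟨Z, fun Z' h => by rw [smul_mul_assoc, hZ _ h]⟩

theorem homogeneousSpan_succ_le (m : ℕ) :
    c.homogeneousSpan F 0 0 (m + 1) ≤
      Submodule.span F (Set.range c.vertex) ⊔ c.homogeneousSpan F 1 1 m := by
  refine Submodule.span_le.2 ?_
  rintro x ⟨i, hi, hx⟩
  cases i with
  | zero =>
    generalize ha : 0 + 0 = a at hx
    cases hx with
    | vertex v => exact Submodule.mem_sup_left (Submodule.subset_span ⟨v, rfl⟩)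
    | edge_mul => omega
    | mul_ghost => omega
  | succ i =>
    refine Submodule.mem_sup_right (Submodule.subset_span ⟨i, by omega, ?_⟩)
    rwa [Nat.add_comm 1 i, ← Nat.zero_add (i + 1)]

theorem smul_mem_twoSidedIdeal {x : R} (r : F) (hx : x ∈ J) : r • x ∈ J := by
  rw [Algebra.smul_def]
  exact J.mul_mem_left _ _ hx

theorem ghost_mul_mul_edge_mem_homogeneousSpan {m : ℕ} {x : R}
    (hx : x ∈ Submodule.span F (Set.range c.vertex)) (e f : Quiver.Total W) :
    c.ghost e * x * c.edge f ∈ c.homogeneousSpan F 0 0 m := by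
  induction hx using Submodule.span_induction with
  | mem x hx =>
    obtain ⟨v, rfl⟩ := hx
    rcases eq_or_ne v e.left with rfl | hv
    · rw [c.ghost_mul_source]
      rcases eq_or_ne e f with rfl | h
      · rw [c.ghost_mul_edge_self]
        exact Submodule.subset_span ⟨0, Nat.zero_le _, .vertex _⟩
      · rw [c.ghost_mul_edge_of_ne h]
        exact zero_mem _
    · rw [c.ghost_mul_vertex_of_ne hv, zero_mul]
      exact zero_mem _
  | zero => rw [mul_zero, zero_mul]; exact zero_mem _
  | add x y _ _ hx hy => rw [mul_add, add_mul]; exact add_mem hx hy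
  | smul r x _ hx => rw [mul_smul_comm, smul_mul_assoc]; exact Submodule.smul_mem _ _ hx

/-- Vertices are orthogonal idempotents, so multiplying by one isolates its term. -/
theorem exists_vertex_mul_eq_smul {x : R} (hx : x ∈ Submodule.span F (Set.range c.vertex)) :
    ∃ r : W →₀ F, x = r.sum (fun v a => a • c.vertex v) ∧ ∀ v, c.vertex v * x = r v • c.vertex v := by
  classical
  obtain ⟨r, rfl⟩ := Finsupp.mem_span_range_iff_exists_finsupp.1 hx
  refine ⟨r, rfl, fun v => ?_⟩
  rw [Finsupp.sum, Finset.mul_sum, Finset.sum_eq_single v]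
  · rw [mul_smul_comm, c.vertex_mul_self]
  · intro w _ hw
    rw [mul_smul_comm, c.vertex_mul_of_ne hw.symm, smul_zero]
  · intro h
    rw [Finsupp.notMem_support_iff.1 h, zero_smul, mul_zero]

theorem mul_one_sub_mem_of_mem_span_vertex (hH : ∀ v, c.vertex v ∈ I → c.vertex v ∈ J)
    (hS : ∀ v, (∃ Z, c.vertex v * (1 - c.rangeProjection Z) ∈ I) →
      ∃ Z, c.vertex v * (1 - c.rangeProjection Z) ∈ J)
    {x : R} (hx : x ∈ Submodule.span F (Set.range c.vertex)) {Z : Finset (Quiver.Total W)}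
    (hI : x * (1 - c.rangeProjection Z) ∈ I) : x * (1 - c.rangeProjection Z) ∈ J := by
  obtain ⟨r, rfl, hr⟩ := exists_vertex_mul_eq_smul hx
  rw [Finsupp.sum, Finset.sum_mul]
  refine sum_mem fun v hv => ?_
  rw [smul_mul_assoc]
  apply smul_mem_twoSidedIdeal
  have h1 := I.mul_mem_left (c.vertex v) _ hI
  rw [← mul_assoc, hr v, smul_mul_assoc] at h1
  have h2 : c.vertex v * (1 - c.rangeProjection Z) ∈ I := by
    have := smul_mem_twoSidedIdeal (r v)⁻¹ h1
    rwa [inv_smul_smul₀ (Finsupp.mem_support_iff.1 hv)] at this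
  obtain ⟨Z', hZ'⟩ := hS v ⟨Z, h2⟩
  exact vertex_mul_one_sub_mem hH h2 hZ'

/-- Induction on the length of the monomials. Write `x = x₀ + x₁`, with `x₀` a combination of
vertices and `x₁` made of monomials with an edge and a ghost edge. If `P` is a range projection
fixing `x₁` on both sides, then `x = P x P + x₀ (1 - P)`. The first term is a sum of `e (e^* x f)
f^*` with shorter inner factors; the second is handled vertex by vertex. -/
theorem mem_of_mem_homogeneousSpan_zero (hH : ∀ v, c.vertex v ∈ I → c.vertex v ∈ J)
    (hS : ∀ v, (∃ Z, c.vertex v * (1 - c.rangeProjection Z) ∈ I) →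
      ∃ Z, c.vertex v * (1 - c.rangeProjection Z) ∈ J)
    (m : ℕ) {x : R} (hx : x ∈ c.homogeneousSpan F 0 0 m) (hI : x ∈ I) : x ∈ J := by
  classical
  induction m generalizing x with
  | zero =>
    have hx' : x ∈ Submodule.span F (Set.range c.vertex) := by
      refine (Submodule.span_mono ?_) hx
      rintro y ⟨i, hi, hy⟩
      obtain rfl : i = 0 := by omega
      generalize ha : 0 + 0 = a at hy
      cases hy with
      | vertex v => exact ⟨v, rfl⟩
      | edge_mul => omega
      | mul_ghost => omega
    obtain ⟨r, hr, hv⟩ := exists_vertex_mul_eq_smul hx'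
    rw [hr]
    refine sum_mem fun v hvs => smul_mem_twoSidedIdeal _ (hH v ?_)
    have h1 := I.mul_mem_left (c.vertex v) _ hI
    rw [hv v] at h1
    have := smul_mem_twoSidedIdeal (r v)⁻¹ h1
    rwa [inv_smul_smul₀ (Finsupp.mem_support_iff.1 hvs)] at this
  | succ m ih =>
    obtain ⟨x₀, hx₀, x₁, hx₁, rfl⟩ := Submodule.mem_sup.1 (homogeneousSpan_succ_le m hx)
    obtain ⟨Z₁, hZ₁⟩ := exists_rangeProjection_mul (k := 0) hx₁
    obtain ⟨Z₂, hZ₂⟩ := exists_mul_rangeProjection (l := 0) hx₁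
    set P := c.rangeProjection (Z₁ ∪ Z₂) with hP
    have h1 : P * x₁ = x₁ := hZ₁ _ Finset.subset_union_left
    have h2 : x₁ * P = x₁ := hZ₂ _ Finset.subset_union_right
    have h3 : P * x₀ = x₀ * P := by
      obtain ⟨r, hr, -⟩ := exists_vertex_mul_eq_smul hx₀
      rw [hr, Finsupp.sum, Finset.mul_sum, Finset.sum_mul]
      refine Finset.sum_congr rfl fun v _ => ?_
      rw [mul_smul_comm, smul_mul_assoc, (commute_vertex_rangeProjection v _).eq]
    have h4 : P * (x₀ + x₁) * P ∈ J := by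
      rw [hP, mul_rangeProjection]
      refine sum_mem fun f _ => ?_
      rw [rangeProjection_mul, Finset.sum_mul, Finset.sum_mul]
      refine sum_mem fun e _ => ?_
      have : c.ghost e * (x₀ + x₁) * c.edge f ∈ J := by
        refine ih ?_ (I.mul_mem_right _ _ (I.mul_mem_left _ _ hI))
        rw [mul_add, add_mul]
        exact add_mem (ghost_mul_mul_edge_mem_homogeneousSpan hx₀ e f)
          (mul_edge_mem_homogeneousSpan (ghost_mul_mem_homogeneousSpan hx₁ e) f)
      have := J.mul_mem_right _ (c.ghost f) (J.mul_mem_left (c.edge e) _ this)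
      simpa only [mul_assoc] using this
    have h5 : x₀ + x₁ = P * (x₀ + x₁) * P + x₀ * (1 - P) := by
      have : x₀ * P * P = x₀ * P := by rw [mul_assoc, rangeProjection_mul_self]
      rw [mul_add, add_mul, h1, h2, h3, this, mul_sub, mul_one]
      abel
    have h6 : x₀ * (1 - P) ∈ I := by
      have : x₀ * (1 - P) = (x₀ + x₁) - P * (x₀ + x₁) * P := by
        conv_rhs => enter [1]; rw [h5]
        abel
      rw [this]
      exact sub_mem hI (I.mul_mem_right _ _ (I.mul_mem_left _ _ hI))
    rw [h5]
    exact add_mem h4 (mul_one_sub_mem_of_mem_span_vertex hH hS hx₀ h6)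

/-- Surplus edges or ghost edges are removed one at a time through `x = ∑ e (e^* x)` and `x = ∑ (x
e) e^*`, which reduces to degree zero. -/
theorem mem_of_mem_homogeneousSpan (hH : ∀ v, c.vertex v ∈ I → c.vertex v ∈ J)
    (hS : ∀ v, (∃ Z, c.vertex v * (1 - c.rangeProjection Z) ∈ I) →
      ∃ Z, c.vertex v * (1 - c.rangeProjection Z) ∈ J)
    (k l m : ℕ) {x : R} (hx : x ∈ c.homogeneousSpan F k l m) (hI : x ∈ I) : x ∈ J := by
  induction k generalizing x with
  | zero =>
    induction l generalizing x with
    | zero => exact mem_of_mem_homogeneousSpan_zero hH hS m hx hI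
    | succ l ih =>
      obtain ⟨Z, hZ⟩ := exists_mul_rangeProjection hx
      rw [← hZ Z subset_rfl, mul_rangeProjection]
      refine sum_mem fun e _ => ?_
      exact J.mul_mem_right _ _ (ih (mul_edge_mem_homogeneousSpan hx e) (I.mul_mem_right _ _ hI))
  | succ k ih =>
    obtain ⟨Z, hZ⟩ := exists_rangeProjection_mul hx
    rw [← hZ Z subset_rfl, rangeProjection_mul]
    refine sum_mem fun e _ => ?_
    exact J.mul_mem_left _ _ (ih (ghost_mul_mem_homogeneousSpan hx e) (I.mul_mem_left _ _ hI))

end Ideals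

end CohnFamily

end Quiver

/-! ### Powers of `1 + X` over a noncommutative ring -/

namespace PowerSeries

variable {R : Type*} [Ring R]

/-- The coefficients are integer multiples of `1`, hence central. -/
theorem commute_binomialSeries (n : ℤ) (x : R⟦X⟧) : Commute (binomialSeries R n) x := by
  ext k
  rw [coeff_mul, coeff_mul, ← Finset.Nat.sum_antidiagonal_swap]
  refine Finset.sum_congr rfl fun p _ => ?_
  simpa using (Int.cast_commute _ _).eq

theorem C_mul_binomialSeries_mul (a b : R) (m n : ℤ) :
    C a * binomialSeries R m * (C b * binomialSeries R n) =
      C (a * b) * binomialSeries R (m + n) := by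
  rw [mul_assoc, ← mul_assoc (binomialSeries R m), (commute_binomialSeries m (C b)).eq,
    binomialSeries_add, map_mul]
  simp only [mul_assoc]

/-- The system is unitriangular: at `k = a + N` with `a` the largest index, every other binomial
coefficient vanishes. No division occurs, so the characteristic plays no role. -/
theorem mem_of_sum_choose_mul_mem {S : AddSubgroup R} (N : ℤ) (T : Finset ℤ)
    (hT : ∀ n ∈ T, 0 ≤ n + N) (x : ℤ → R)
    (h : ∀ k, ∑ n ∈ T, (n + N).toNat.choose k • x n ∈ S) : ∀ n ∈ T, x n ∈ S := by
  induction T using Finset.induction_on_max with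
  | empty => simp
  | insert a T ha ih =>
    have haT : a ∉ T := fun h => lt_irrefl _ (ha a h)
    have hx : x a ∈ S := by
      have := h (a + N).toNat
      rw [Finset.sum_insert haT, Finset.sum_eq_zero, Nat.choose_self, one_nsmul, add_zero] at this
      · exact this
      · intro n hn
        have h1 := hT n (Finset.mem_insert_of_mem hn)
        have h2 := ha n hn
        rw [Nat.choose_eq_zero_of_lt (by omega), zero_nsmul]
    intro n hn
    rcases Finset.mem_insert.1 hn with rfl | hn
    · exact hx
    · refine ih (fun n hn => hT n (Finset.mem_insert_of_mem hn)) (fun k => ?_) n hn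
      have := S.sub_mem (h k) (S.nsmul_mem hx ((a + N).toNat.choose k))
      rwa [Finset.sum_insert haT, add_sub_cancel_left] at this

/-- If all coefficients of `∑ n, xₙ (1 + X) ^ n` lie in an additive subgroup, so do all `xₙ`. -/
theorem mem_of_coeff_sum_binomialSeries_mem {S : AddSubgroup R} (T : Finset ℤ) (x : ℤ → R)
    (h : ∀ k, coeff k (∑ n ∈ T, C (x n) * binomialSeries R n) ∈ S) : ∀ n ∈ T, x n ∈ S := by
  obtain ⟨N, hN⟩ : ∃ N : ℤ, ∀ n ∈ T, 0 ≤ n + N := by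
    obtain ⟨b, hb⟩ := T.bddBelow
    exact ⟨-b, fun n hn => by have := hb hn; omega⟩
  refine mem_of_sum_choose_mul_mem N T hN x fun k => ?_
  -- Multiplying by `(1 + X) ^ N` makes all exponents nonnegative and replaces each coefficient by
  -- an integer combination of given ones.
  have h1 : ∑ n ∈ T, (n + N).toNat.choose k • x n =
      coeff k ((∑ n ∈ T, C (x n) * binomialSeries R n) * binomialSeries R N) := by
    rw [Finset.sum_mul, map_sum]
    refine Finset.sum_congr rfl fun n hn => ?_
    have h2 : Ring.choose (n + N) k = ((n + N).toNat.choose k : ℤ) := by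
      conv_lhs => rw [← Int.toNat_of_nonneg (hN n hn), Ring.choose_natCast]
    rw [mul_assoc, ← binomialSeries_add, coeff_C_mul, binomialSeries_coeff, h2, mul_smul_comm,
      mul_one, natCast_zsmul]
  rw [h1, coeff_mul]
  refine sum_mem fun p _ => ?_
  rw [binomialSeries_coeff, mul_smul_comm, mul_one]
  exact S.zsmul_mem (h _) _

end PowerSeries

/-! ### Spans of monomials and the decomposition by degree -/

namespace Quiver

namespace CohnFamily

variable {W : Type*} [Quiver W] {R : Type*} [Ring R] {c : CohnFamily W R}

section Span

variable (F : Type*) [Field F] [Algebra F R]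

variable (c) in
/-- The span of all monomials. -/
def monomialSpan : Submodule F R := Submodule.span F {x | ∃ a b, c.IsMonomial a b x}

variable (c) in
/-- The span of the monomials of degree `n`. -/
def degreeSpan (n : ℤ) : Submodule F R :=
  Submodule.span F {x | ∃ a b : ℕ, (a : ℤ) - b = n ∧ c.IsMonomial a b x}

variable {F}

theorem IsMonomial.mem_monomialSpan {a b : ℕ} {x : R} (h : c.IsMonomial a b x) :
    x ∈ c.monomialSpan F := Submodule.subset_span ⟨a, b, h⟩

theorem edge_mem_monomialSpan (e : Quiver.Total W) : c.edge e ∈ c.monomialSpan F := by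
  rw [← c.edge_mul_range]
  exact ((IsMonomial.vertex _).edge_mul e).mem_monomialSpan

theorem ghost_mem_monomialSpan (e : Quiver.Total W) : c.ghost e ∈ c.monomialSpan F := by
  rw [← c.range_mul_ghost]
  exact ((IsMonomial.vertex _).mul_ghost e).mem_monomialSpan

theorem mul_mem_monomialSpan_of_forall {y : R}
    (h : ∀ a b x, c.IsMonomial a b x → y * x ∈ c.monomialSpan F) {x : R}
    (hx : x ∈ c.monomialSpan F) : y * x ∈ c.monomialSpan F := by
  have : c.monomialSpan F ≤ (c.monomialSpan F).comap (LinearMap.mulLeft F y) :=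
    Submodule.span_le.2 fun x ⟨a, b, hx⟩ => h a b x hx
  exact this hx

theorem mul_ghost_mem_monomialSpan (e : Quiver.Total W) {x : R} (hx : x ∈ c.monomialSpan F) :
    x * c.ghost e ∈ c.monomialSpan F := by
  have : c.monomialSpan F ≤ (c.monomialSpan F).comap (LinearMap.mulRight F (c.ghost e)) :=
    Submodule.span_le.2 fun x ⟨a, b, hx⟩ => (hx.mul_ghost e).mem_monomialSpan
  exact this hx

theorem vertex_mul_mem_monomialSpan (v : W) {x : R} (hx : x ∈ c.monomialSpan F) :
    c.vertex v * x ∈ c.monomialSpan F := by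
  refine mul_mem_monomialSpan_of_forall (fun a b x hx => ?_) hx
  rcases hx.vertex_mul v with h | h <;> rw [h]
  exacts [hx.mem_monomialSpan, zero_mem _]

theorem edge_mul_mem_monomialSpan (e : Quiver.Total W) {x : R} (hx : x ∈ c.monomialSpan F) :
    c.edge e * x ∈ c.monomialSpan F :=
  mul_mem_monomialSpan_of_forall (fun _ _ _ hx => (hx.edge_mul e).mem_monomialSpan) hx

theorem ghost_mul_mem_monomialSpan (e : Quiver.Total W) {x : R} (hx : x ∈ c.monomialSpan F) :
    c.ghost e * x ∈ c.monomialSpan F := by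
  refine mul_mem_monomialSpan_of_forall (fun a b x hx => ?_) hx
  induction hx with
  | vertex v =>
    rcases eq_or_ne v e.left with rfl | hv
    · rw [c.ghost_mul_source]
      exact ghost_mem_monomialSpan e
    · rw [c.ghost_mul_vertex_of_ne hv]
      exact zero_mem _
  | edge_mul f hx _ =>
    rw [← mul_assoc]
    rcases eq_or_ne e f with rfl | h
    · rw [c.ghost_mul_edge_self]
      exact vertex_mul_mem_monomialSpan _ hx.mem_monomialSpan
    · rw [c.ghost_mul_edge_of_ne h, zero_mul]
      exact zero_mem _
  | mul_ghost f _ ih =>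
    rw [← mul_assoc]
    exact mul_ghost_mem_monomialSpan f ih

theorem exists_sum_degreeSpan {x : R} (hx : x ∈ c.monomialSpan F) :
    ∃ (T : Finset ℤ) (y : ℤ → R), (∀ n, y n ∈ c.degreeSpan F n) ∧ ∑ n ∈ T, y n = x := by
  have : c.monomialSpan F ≤ ⨆ n, c.degreeSpan F n := Submodule.span_le.2 fun x ⟨a, b, hx⟩ =>
    Submodule.mem_iSup_of_mem (a - b : ℤ) (Submodule.subset_span ⟨a, b, rfl, hx⟩)
  obtain ⟨f, hf, hfx⟩ := (Submodule.mem_iSup_iff_exists_finsupp _ _).1 (this hx)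
  exact ⟨f.support, f, hf, hfx⟩

theorem exists_mem_homogeneousSpan {n : ℤ} {x : R} (hx : x ∈ c.degreeSpan F n) :
    ∃ m, x ∈ c.homogeneousSpan F n.toNat (-n).toNat m := by
  induction hx using Submodule.span_induction with
  | mem x hx =>
    obtain ⟨a, b, hn, hx⟩ := hx
    -- With `a - b = n`, the numbers `a` and `b` exceed the positive and negative parts of `n` by
    -- the same amount `a - n.toNat`.
    refine ⟨a, Submodule.subset_span ⟨a - n.toNat, Nat.sub_le _ _, ?_⟩⟩
    convert hx using 1 <;> omega
  | zero => exact ⟨0, zero_mem _⟩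
  | add x y _ _ hx hy =>
    obtain ⟨m, hm⟩ := hx
    obtain ⟨m', hm'⟩ := hy
    exact ⟨max m m', add_mem (homogeneousSpan_mono (le_max_left _ _) hm)
      (homogeneousSpan_mono (le_max_right _ _) hm')⟩
  | smul r x _ hx =>
    obtain ⟨m, hm⟩ := hx
    exact ⟨m, Submodule.smul_mem _ _ hm⟩

theorem exists_finset_vertex_mul_eq_zero {x : R} (hx : x ∈ c.monomialSpan F) :
    ∃ T : Finset W, ∀ v ∉ T, c.vertex v * x = 0 := by
  classical
  induction hx using Submodule.span_induction with
  | mem x hx =>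
    obtain ⟨a, b, hx⟩ := hx
    obtain ⟨w, -, hw⟩ := hx.exists_vertex_mul
    exact ⟨{w}, fun v hv => hw v (by simpa using hv)⟩
  | zero => exact ⟨∅, fun _ _ => mul_zero _⟩
  | add x y _ _ hx hy =>
    obtain ⟨T, hT⟩ := hx
    obtain ⟨S, hS⟩ := hy
    refine ⟨T ∪ S, fun v hv => ?_⟩
    rw [Finset.notMem_union] at hv
    rw [mul_add, hT v hv.1, hS v hv.2, add_zero]
  | smul r x _ hx =>
    obtain ⟨T, hT⟩ := hx
    exact ⟨T, fun v hv => by rw [mul_smul_comm, hT v hv, smul_zero]⟩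

end Span

end CohnFamily

/-! ### The coaction, and finiteness for graph algebras -/

section Leavitt

open PowerSeries

variable (W : Type*) [Quiver W] (F : Type*) [Field F]

/-- The unital algebra with the same presentation as the Leavitt path algebra. -/
abbrev UnitalLeavittAlgebra := RingQuot (LeavittRel W F)

variable {W F} in
theorem mkAlgHom_eq {a b : FreeAlgebra F (LeavittGenerator W)} (h : LeavittRel W F a b) :
    RingQuot.mkAlgHom F (LeavittRel W F) a = RingQuot.mkAlgHom F (LeavittRel W F) b :=
  RingQuot.mkAlgHom_rel F h

/-- The generators of the Leavitt path algebra. -/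
def leavittFamily : CohnFamily W (UnitalLeavittAlgebra W F) where
  vertex v := RingQuot.mkAlgHom F (LeavittRel W F) (p W F v)
  edge e := RingQuot.mkAlgHom F (LeavittRel W F) (s W F e)
  ghost e := RingQuot.mkAlgHom F (LeavittRel W F) (sStar W F e)
  vertex_mul_self v := by rw [← map_mul]; exact mkAlgHom_eq (.vertex_mul_self v)
  vertex_mul_of_ne h := by rw [← map_mul, mkAlgHom_eq (.vertex_mul_of_ne h), map_zero]
  source_mul_edge e := by rw [← map_mul]; exact mkAlgHom_eq (.source_mul_edge e)
  edge_mul_range e := by rw [← map_mul]; exact mkAlgHom_eq (.edge_mul_range e)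
  range_mul_ghost e := by rw [← map_mul]; exact mkAlgHom_eq (.range_mul_ghost e)
  ghost_mul_source e := by rw [← map_mul]; exact mkAlgHom_eq (.ghost_mul_source e)
  ghost_mul_edge_self e := by rw [← map_mul]; exact mkAlgHom_eq (.ghost_mul_edge_self e)
  ghost_mul_edge_of_ne h := by rw [← map_mul, mkAlgHom_eq (.ghost_mul_edge_of_ne h), map_zero]

variable {W} in
theorem leavittFamily_vertex_regular (v : W) (hv : IsRegular W v) :
    (leavittFamily W F).vertex v =
      ∑ e ∈ hv.2.toFinset, (leavittFamily W F).edge e * (leavittFamily W F).ghost e := by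
  have h := mkAlgHom_eq (F := F) (.regular v hv)
  simp only [map_sum, map_mul] at h
  exact h

/-- The images of the generators under the coaction. -/
noncomputable def coactionGenerator : LeavittGenerator W → (UnitalLeavittAlgebra W F)⟦X⟧
  | .vertex v => C ((leavittFamily W F).vertex v) * binomialSeries _ (0 : ℤ)
  | .edge e => C ((leavittFamily W F).edge e) * binomialSeries _ (1 : ℤ)
  | .ghost e => C ((leavittFamily W F).ghost e) * binomialSeries _ (-1 : ℤ)

/-- All defining relations are homogeneous when edges have degree `1` and ghost edges degree `-1`.
Using `1 + X` as the grading variable makes the identity the constant term, so the coefficients can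
be treated by induction. -/
theorem exists_coaction : ∃ δ : UnitalLeavittAlgebra W F →ₐ[F] (UnitalLeavittAlgebra W F)⟦X⟧,
    ∀ g, δ (RingQuot.mkAlgHom F (LeavittRel W F) (FreeAlgebra.ι F g)) =
      coactionGenerator W F g := by
  refine ⟨RingQuot.liftAlgHom F ⟨FreeAlgebra.lift F (coactionGenerator W F), ?_⟩, fun g => ?_⟩
  · intro a b h
    induction h with
    | vertex_mul_self v =>
      simp only [p, map_mul, FreeAlgebra.lift_ι_apply, coactionGenerator,
        C_mul_binomialSeries_mul, CohnFamily.vertex_mul_self, add_zero]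
    | vertex_mul_of_ne h =>
      simp only [p, map_mul, FreeAlgebra.lift_ι_apply, coactionGenerator,
        C_mul_binomialSeries_mul, CohnFamily.vertex_mul_of_ne _ h, map_zero, zero_mul]
    | source_mul_edge e =>
      simp only [p, s, map_mul, FreeAlgebra.lift_ι_apply, coactionGenerator,
        C_mul_binomialSeries_mul, CohnFamily.source_mul_edge, zero_add]
    | edge_mul_range e =>
      simp only [p, s, map_mul, FreeAlgebra.lift_ι_apply, coactionGenerator,
        C_mul_binomialSeries_mul, CohnFamily.edge_mul_range, add_zero]
    | range_mul_ghost e =>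
      simp only [p, sStar, map_mul, FreeAlgebra.lift_ι_apply, coactionGenerator,
        C_mul_binomialSeries_mul, CohnFamily.range_mul_ghost, zero_add]
    | ghost_mul_source e =>
      simp only [p, sStar, map_mul, FreeAlgebra.lift_ι_apply, coactionGenerator,
        C_mul_binomialSeries_mul, CohnFamily.ghost_mul_source, add_zero]
    | ghost_mul_edge_self e =>
      simp only [p, s, sStar, map_mul, FreeAlgebra.lift_ι_apply, coactionGenerator,
        C_mul_binomialSeries_mul, CohnFamily.ghost_mul_edge_self, neg_add_cancel]
    | ghost_mul_edge_of_ne h =>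
      simp only [s, sStar, map_mul, FreeAlgebra.lift_ι_apply, coactionGenerator,
        C_mul_binomialSeries_mul, CohnFamily.ghost_mul_edge_of_ne _ h, map_zero, zero_mul]
    | regular v hv =>
      simp only [p, s, sStar, map_sum, map_mul (FreeAlgebra.lift F _), FreeAlgebra.lift_ι_apply, coactionGenerator,
        C_mul_binomialSeries_mul, add_neg_cancel, ← Finset.sum_mul]
      rw [leavittFamily_vertex_regular F v hv, map_sum]
  · simp

/-- The coaction `δ(x) = x (1 + X) ^ n` for `x` homogeneous of degree `n`. -/
noncomputable def coaction : UnitalLeavittAlgebra W F →ₐ[F] (UnitalLeavittAlgebra W F)⟦X⟧ :=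
  (exists_coaction W F).choose

variable {W F}

theorem coaction_isMonomial {a b : ℕ} {x : UnitalLeavittAlgebra W F}
    (hx : (leavittFamily W F).IsMonomial a b x) :
    coaction W F x = C x * binomialSeries _ (a - b : ℤ) := by
  have h := (exists_coaction W F).choose_spec
  induction hx with
  | vertex v => exact h (.vertex v)
  | edge_mul e hx ih =>
    have he : coaction W F ((leavittFamily W F).edge e) = _ := h (.edge e)
    rw [map_mul, he, ih, coactionGenerator, C_mul_binomialSeries_mul]
    congr 2
    push_cast
    ring
  | mul_ghost e hx ih =>
    have he : coaction W F ((leavittFamily W F).ghost e) = _ := h (.ghost e)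
    rw [map_mul, he, ih, coactionGenerator, C_mul_binomialSeries_mul]
    congr 2
    push_cast
    ring

theorem C_smul_mul (r : F) (x : UnitalLeavittAlgebra W F) (y : (UnitalLeavittAlgebra W F)⟦X⟧) :
    C (r • x) * y = r • (C x * y) := by
  ext k
  rw [coeff_C_mul, PowerSeries.coeff_smul, coeff_C_mul, smul_mul_assoc]

theorem coaction_of_mem_degreeSpan {n : ℤ} {x : UnitalLeavittAlgebra W F}
    (hx : x ∈ (leavittFamily W F).degreeSpan F n) :
    coaction W F x = C x * binomialSeries _ n := by
  induction hx using Submodule.span_induction with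
  | mem x hx =>
    obtain ⟨a, b, rfl, hx⟩ := hx
    exact coaction_isMonomial hx
  | zero => simp
  | add x y _ _ hx hy => rw [map_add, hx, hy, map_add, add_mul]
  | smul r x _ hx => rw [map_smul, hx, C_smul_mul]

theorem coeff_zero_coaction {x : UnitalLeavittAlgebra W F}
    (hx : x ∈ (leavittFamily W F).monomialSpan F) : coeff 0 (coaction W F x) = x := by
  obtain ⟨T, y, hy, rfl⟩ := CohnFamily.exists_sum_degreeSpan hx
  rw [map_sum, map_sum]
  refine Finset.sum_congr rfl fun n _ => ?_
  rw [coaction_of_mem_degreeSpan (hy n), coeff_C_mul]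
  simp

theorem leavittPathAlgebra_le_monomialSpan {x : UnitalLeavittAlgebra W F}
    (hx : x ∈ LeavittPathAlgebra W F) : x ∈ (leavittFamily W F).monomialSpan F := by
  -- Stability of the span under left multiplication by `x` is carried along to make the product
  -- case go through.
  suffices h : x ∈ (leavittFamily W F).monomialSpan F ∧
      ∀ y ∈ (leavittFamily W F).monomialSpan F, x * y ∈ (leavittFamily W F).monomialSpan F from h.1
  induction hx using NonUnitalAlgebra.adjoin_induction with
  | mem x hx =>
    obtain ⟨g, rfl⟩ := hx
    cases g with
    | vertex v =>
      exact ⟨(CohnFamily.IsMonomial.vertex (c := leavittFamily W F) v).mem_monomialSpan,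
        fun y hy => CohnFamily.vertex_mul_mem_monomialSpan v hy⟩
    | edge e =>
      exact ⟨CohnFamily.edge_mem_monomialSpan e,
        fun y hy => CohnFamily.edge_mul_mem_monomialSpan e hy⟩
    | ghost e =>
      exact ⟨CohnFamily.ghost_mem_monomialSpan e,
        fun y hy => CohnFamily.ghost_mul_mem_monomialSpan e hy⟩
  | add x y _ _ hx hy =>
    exact ⟨add_mem hx.1 hy.1, fun z hz => by
      rw [add_mul]; exact add_mem (hx.2 z hz) (hy.2 z hz)⟩
  | zero => exact ⟨zero_mem _, fun z _ => by rw [zero_mul]; exact zero_mem _⟩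
  | mul x y _ _ hx hy =>
    exact ⟨hx.2 y hy.1, fun z hz => by rw [mul_assoc]; exact hx.2 _ (hy.2 z hz)⟩
  | smul r x _ hx =>
    exact ⟨Submodule.smul_mem _ _ hx.1, fun z hz => by
      rw [smul_mul_assoc]; exact Submodule.smul_mem _ _ (hx.2 z hz)⟩

theorem mul_mem_leavittPathAlgebra (r : UnitalLeavittAlgebra W F) :
    ∀ x ∈ LeavittPathAlgebra W F, r * x ∈ LeavittPathAlgebra W F ∧
      x * r ∈ LeavittPathAlgebra W F := by
  obtain ⟨r, rfl⟩ := RingQuot.mkAlgHom_surjective F (LeavittRel W F) r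
  induction r using FreeAlgebra.induction with
  | grade0 a =>
    intro x hx
    rw [AlgHom.commutes, ← Algebra.smul_def, ← Algebra.commutes, ← Algebra.smul_def]
    exact ⟨SMulMemClass.smul_mem a hx, SMulMemClass.smul_mem a hx⟩
  | grade1 g =>
    intro x hx
    have hg := NonUnitalAlgebra.subset_adjoin F (s := Set.range fun x : LeavittGenerator W =>
      RingQuot.mkAlgHom F (LeavittRel W F) (FreeAlgebra.ι F x)) ⟨g, rfl⟩
    exact ⟨mul_mem hg hx, mul_mem hx hg⟩
  | mul a b ha hb =>
    intro x hx
    rw [map_mul]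
    exact ⟨by rw [mul_assoc]; exact (ha _ (hb x hx).1).1,
      by rw [← mul_assoc]; exact (hb _ (ha x hx).2).2⟩
  | add a b ha hb =>
    intro x hx
    rw [map_add, add_mul, mul_add]
    exact ⟨add_mem (ha x hx).1 (hb x hx).1, add_mem (ha x hx).2 (hb x hx).2⟩

/-- A two-sided ideal of a unital Leavitt path algebra, as an ideal of the larger algebra with
the same presentation. -/
def extendIdeal {u : LeavittPathAlgebra W F}
    (hu : ∀ x : LeavittPathAlgebra W F, u * x = x ∧ x * u = x)
    (I : TwoSidedIdeal (LeavittPathAlgebra W F)) : TwoSidedIdeal (UnitalLeavittAlgebra W F) :=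
  .mk' {x | ∃ y ∈ I, (y : UnitalLeavittAlgebra W F) = x}
    ⟨0, I.zero_mem, rfl⟩
    (by
      rintro _ _ ⟨x, hx, rfl⟩ ⟨y, hy, rfl⟩
      exact ⟨x + y, I.add_mem hx hy, rfl⟩)
    (by
      rintro _ ⟨x, hx, rfl⟩
      exact ⟨-x, I.neg_mem hx, rfl⟩)
    (by
      rintro r _ ⟨x, hx, rfl⟩
      -- Since `x = u x`, multiplying by `r` is multiplying by `r u`, which lies in the smaller
      -- algebra.
      refine ⟨⟨r * u, (mul_mem_leavittPathAlgebra r u u.2).1⟩ * x, I.mul_mem_left _ _ hx, ?_⟩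
      rw [NonUnitalSubalgebra.coe_mul, mul_assoc, ← NonUnitalSubalgebra.coe_mul, (hu x).1])
    (by
      rintro _ r ⟨x, hx, rfl⟩
      refine ⟨x * ⟨u * r, (mul_mem_leavittPathAlgebra r u u.2).2⟩, I.mul_mem_right _ _ hx, ?_⟩
      rw [NonUnitalSubalgebra.coe_mul, ← mul_assoc, ← NonUnitalSubalgebra.coe_mul, (hu x).2])

variable {u : LeavittPathAlgebra W F} (hu : ∀ x : LeavittPathAlgebra W F, u * x = x ∧ x * u = x)

include hu

theorem coe_mem_extendIdeal {I : TwoSidedIdeal (LeavittPathAlgebra W F)}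
    {x : LeavittPathAlgebra W F} : (x : UnitalLeavittAlgebra W F) ∈ extendIdeal hu I ↔ x ∈ I := by
  rw [extendIdeal, TwoSidedIdeal.mem_mk']
  constructor
  · rintro ⟨y, hy, h⟩
    rwa [← Subtype.ext h]
  · exact fun h => ⟨x, h, rfl⟩

/-- The coefficients of the coaction obey the Leibniz rule of a higher derivation, so one
idempotency step gains one coefficient. -/
theorem coeff_coaction_mem_of_isIdempotent {I : TwoSidedIdeal (LeavittPathAlgebra W F)}
    (hI : I.IsIdempotent) (k : ℕ) :
    ∀ x ∈ I, ∀ i ≤ k, coeff i (coaction W F x) ∈ extendIdeal hu I := by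
  have h0 : ∀ x ∈ I, coeff 0 (coaction W F x) ∈ extendIdeal hu I := by
    intro x hx
    rw [coeff_zero_coaction (leavittPathAlgebra_le_monomialSpan x.2)]
    exact (coe_mem_extendIdeal hu).2 hx
  induction k with
  | zero =>
    intro x hx i hi
    rw [Nat.le_zero.1 hi]
    exact h0 x hx
  | succ k ih =>
    let J : TwoSidedIdeal (LeavittPathAlgebra W F) :=
      .mk' {x | ∀ i ≤ k + 1, coeff i (coaction W F x) ∈ extendIdeal hu I}
        (by
          intro i _
          rw [NonUnitalSubalgebra.coe_zero, map_zero, map_zero]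
          exact TwoSidedIdeal.zero_mem _)
        (by
          intro x y hx hy i hi
          rw [NonUnitalSubalgebra.coe_add, map_add, map_add]
          exact add_mem (hx i hi) (hy i hi))
        (by
          intro x hx i hi
          rw [NonUnitalSubalgebra.coe_neg, map_neg, map_neg]
          exact neg_mem (hx i hi))
        (by
          intro x y hy i hi
          rw [NonUnitalSubalgebra.coe_mul, map_mul, coeff_mul]
          refine sum_mem fun q hq => TwoSidedIdeal.mul_mem_left _ _ _ (hy _ ?_)
          have := Finset.HasAntidiagonal.mem_antidiagonal.1 hq
          omega)
        (by
          intro x y hx i hi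
          rw [NonUnitalSubalgebra.coe_mul, map_mul, coeff_mul]
          refine sum_mem fun q hq => TwoSidedIdeal.mul_mem_right _ _ _ (hx _ ?_)
          have := Finset.HasAntidiagonal.mem_antidiagonal.1 hq
          omega)
    have hJ : I ≤ J := hI J fun y hy z hz => by
      rw [TwoSidedIdeal.mem_mk']
      intro i hi
      rw [NonUnitalSubalgebra.coe_mul, map_mul, coeff_mul]
      refine sum_mem fun q hq => ?_
      have := Finset.HasAntidiagonal.mem_antidiagonal.1 hq
      by_cases h : q.1 ≤ k
      · exact TwoSidedIdeal.mul_mem_right _ _ _ (ih y hy _ h)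
      -- Here `q.1 = k + 1`, so the other factor is the constant coefficient, which is `z` itself.
      · rw [show q.2 = 0 by omega]
        exact TwoSidedIdeal.mul_mem_left _ _ _ (h0 z hz)
    intro x hx
    have := hJ hx
    rwa [TwoSidedIdeal.mem_mk'] at this

theorem le_of_isIdempotent {I J : TwoSidedIdeal (LeavittPathAlgebra W F)} (hI : I.IsIdempotent)
    (hH : ∀ v, (leavittFamily W F).vertex v ∈ extendIdeal hu I →
      (leavittFamily W F).vertex v ∈ extendIdeal hu J)
    (hS : ∀ v, (∃ Z, (leavittFamily W F).vertex v *
        (1 - (leavittFamily W F).rangeProjection Z) ∈ extendIdeal hu I) →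
      ∃ Z, (leavittFamily W F).vertex v *
        (1 - (leavittFamily W F).rangeProjection Z) ∈ extendIdeal hu J) : I ≤ J := by
  intro x hx
  rw [← coe_mem_extendIdeal hu]
  obtain ⟨T, y, hy, hyx⟩ :=
    CohnFamily.exists_sum_degreeSpan (leavittPathAlgebra_le_monomialSpan x.2)
  have hyI : ∀ n ∈ T, y n ∈ (extendIdeal hu I : Set (UnitalLeavittAlgebra W F)) := by
    refine mem_of_coeff_sum_binomialSeries_mem (S := AddSubgroup.ofClass (extendIdeal hu I)) T y
      fun k => ?_
    have : ∑ n ∈ T, C (y n) * binomialSeries _ n = coaction W F x := by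
      rw [← hyx, map_sum]
      exact Finset.sum_congr rfl fun n _ => (coaction_of_mem_degreeSpan (hy n)).symm
    rw [this]
    exact coeff_coaction_mem_of_isIdempotent hu hI k x hx k le_rfl
  rw [← hyx]
  refine sum_mem fun n hn => ?_
  obtain ⟨m, hm⟩ := CohnFamily.exists_mem_homogeneousSpan (hy n)
  exact CohnFamily.mem_of_mem_homogeneousSpan hH hS _ _ m hm (hyI n hn)

/-- Vertices outside a finite set `T` annihilate the unit, so they are zero; the two vertex sets
attached to an idempotent ideal are then determined by their traces on `T`. -/
theorem finite_isIdempotent_leavittPathAlgebra :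
    {I : TwoSidedIdeal (LeavittPathAlgebra W F) | I.IsIdempotent}.Finite := by
  obtain ⟨T, hT⟩ := CohnFamily.exists_finset_vertex_mul_eq_zero
    (leavittPathAlgebra_le_monomialSpan u.2)
  have hT' : ∀ v ∉ T, (leavittFamily W F).vertex v = 0 := fun v hv => by
    have hv' := hT v hv
    have hmem : (leavittFamily W F).vertex v ∈ LeavittPathAlgebra W F :=
      NonUnitalAlgebra.subset_adjoin F ⟨.vertex v, rfl⟩
    have := (hu ⟨_, hmem⟩).2
    exact (congrArg Subtype.val this).symm.trans hv'
  let H : TwoSidedIdeal (LeavittPathAlgebra W F) → Set T := fun I =>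
    {v | (leavittFamily W F).vertex v ∈ extendIdeal hu I}
  let S : TwoSidedIdeal (LeavittPathAlgebra W F) → Set T := fun I =>
    {v | ∃ Z, (leavittFamily W F).vertex v *
        (1 - (leavittFamily W F).rangeProjection Z) ∈ extendIdeal hu I}
  have key : ∀ I J : TwoSidedIdeal (LeavittPathAlgebra W F), I.IsIdempotent →
      H I = H J → S I = S J → I ≤ J := by
    intro I J hI h1 h2
    refine le_of_isIdempotent hu hI (fun v hv => ?_) (fun v hv => ?_)
    · by_cases h : v ∈ T
      · exact (Set.ext_iff.1 h1 ⟨v, h⟩).1 hv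
      · rw [hT' v h]
        exact TwoSidedIdeal.zero_mem _
    · by_cases h : v ∈ T
      · exact (Set.ext_iff.1 h2 ⟨v, h⟩).1 hv
      · refine ⟨∅, ?_⟩
        rw [hT' v h, zero_mul]
        exact TwoSidedIdeal.zero_mem _
  refine Set.Finite.of_injOn (f := fun I => (H I, S I)) (t := Set.univ)
    (fun _ _ => Set.mem_univ _) ?_ Set.finite_univ
  intro I hI J hJ h
  obtain ⟨h1, h2⟩ := Prod.mk.inj h
  exact le_antisymm (key I J hI h1 h2) (key J I hJ h1.symm h2.symm)

end Leavitt

end Quiver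

/-! ### Branching systems and their representations -/

namespace Ultragraph

variable {V E : Type*} (G : Ultragraph V E)

/-- A branching system of an ultragraph: sets `D_A` for the sets `A` of vertices and injective
maps from `D_{r(e)}` to `D_{s(e)}` with disjoint images, which cover `D_v` if `v` is regular. -/
structure BranchingSystem (Y : Type*) where
  set : Set V → Set Y
  map : E → Y → Y
  set_empty : set ∅ = ∅
  set_inter : ∀ A B, set (A ∩ B) = set A ∩ set B
  set_union : ∀ A B, set (A ∪ B) = set A ∪ set B
  map_mem : ∀ {e y}, y ∈ set (G.range e) → map e y ∈ set {G.source e}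
  eq_of_map_eq : ∀ {e e' y y'}, y ∈ set (G.range e) → y' ∈ set (G.range e') →
    map e y = map e' y' → e = e' ∧ y = y'
  exists_map_eq : ∀ {v y}, G.IsRegular v → y ∈ set {v} →
    ∃ e, G.source e = v ∧ ∃ y' ∈ set (G.range e), map e y' = y

namespace BranchingSystem

open scoped Classical

variable {G} {Y : Type*} (B : G.BranchingSystem Y) (K : Type*) [Field K]

/-- The action of `p_A` on functions. -/
noncomputable def projEnd (A : Set V) : Module.End K (Y → K) where
  toFun f y := if y ∈ B.set A then f y else 0
  map_add' f g := by ext y; simp only [Pi.add_apply]; split_ifs <;> simp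
  map_smul' a f := by ext y; simp

/-- The action of `s_e` on functions. -/
noncomputable def edgeEnd (e : E) : Module.End K (Y → K) where
  toFun f y := if h : ∃ y' ∈ B.set (G.range e), B.map e y' = y then f h.choose else 0
  map_add' f g := by ext y; simp only [Pi.add_apply]; split_ifs <;> simp
  map_smul' a f := by ext y; simp

/-- The action of `s_e^*` on functions. -/
noncomputable def ghostEnd (e : E) : Module.End K (Y → K) where
  toFun f y := if y ∈ B.set (G.range e) then f (B.map e y) else 0
  map_add' f g := by ext y; simp only [Pi.add_apply]; split_ifs <;> simp
  map_smul' a f := by ext y; simp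

variable {K}

theorem projEnd_apply (A : Set V) (f : Y → K) (y : Y) :
    B.projEnd K A f y = if y ∈ B.set A then f y else 0 := rfl

theorem ghostEnd_apply (e : E) (f : Y → K) (y : Y) :
    B.ghostEnd K e f y = if y ∈ B.set (G.range e) then f (B.map e y) else 0 := rfl

theorem edgeEnd_apply_map {e : E} {y : Y} (hy : y ∈ B.set (G.range e)) (f : Y → K) :
    B.edgeEnd K e f (B.map e y) = f y := by
  have h : ∃ y' ∈ B.set (G.range e), B.map e y' = B.map e y := ⟨y, hy, rfl⟩
  change dite _ _ _ = _
  rw [dif_pos h, (B.eq_of_map_eq h.choose_spec.1 hy h.choose_spec.2).2]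

theorem edgeEnd_apply_eq_zero {e : E} {y : Y}
    (h : ∀ y' ∈ B.set (G.range e), B.map e y' ≠ y) (f : Y → K) : B.edgeEnd K e f y = 0 :=
  dif_neg fun ⟨y', h1, h2⟩ => h y' h1 h2

variable (K) in
/-- The action of the generators on functions. -/
noncomputable def generatorEnd : G.LeavittGenerator → Module.End K (Y → K)
  | .proj A _ => B.projEnd K A
  | .edge e => B.edgeEnd K e
  | .ghost e => B.ghostEnd K e

theorem lift_eq_of_leavittRel {a b : FreeAlgebra K G.LeavittGenerator} (h : G.LeavittRel K a b) :
    FreeAlgebra.lift K (B.generatorEnd K) a = FreeAlgebra.lift K (B.generatorEnd K) b := by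
  induction h with
  | proj_empty =>
    simp only [p, FreeAlgebra.lift_ι_apply, generatorEnd, map_zero]
    ext1 f; ext y
    simp [projEnd_apply, B.set_empty]
  | proj_mul hA hB =>
    simp only [p, map_mul, FreeAlgebra.lift_ι_apply, generatorEnd]
    refine LinearMap.ext fun f => funext fun y => ?_
    simp only [Module.End.mul_apply, projEnd_apply, B.set_inter, Set.mem_inter_iff]
    split_ifs <;> simp_all
  | proj_union hA hB =>
    simp only [p, map_add, map_sub, FreeAlgebra.lift_ι_apply, generatorEnd]
    refine LinearMap.ext fun f => funext fun y => ?_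
    simp only [LinearMap.add_apply, LinearMap.sub_apply, Pi.add_apply, Pi.sub_apply,
      projEnd_apply, B.set_inter, B.set_union, Set.mem_inter_iff, Set.mem_union]
    split_ifs <;> simp_all
  | source_mul_edge e =>
    simp only [p, s, map_mul, FreeAlgebra.lift_ι_apply, generatorEnd]
    refine LinearMap.ext fun f => funext fun y => ?_
    rw [Module.End.mul_apply, projEnd_apply, ite_eq_left_iff]
    exact fun hy => (B.edgeEnd_apply_eq_zero (by rintro y' h rfl; exact hy (B.map_mem h)) f).symm
  | edge_mul_range e =>
    simp only [p, s, map_mul, FreeAlgebra.lift_ι_apply, generatorEnd]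
    refine LinearMap.ext fun f => funext fun y => ?_
    rw [Module.End.mul_apply]
    by_cases h : ∃ y' ∈ B.set (G.range e), B.map e y' = y
    · obtain ⟨y', h, rfl⟩ := h
      rw [B.edgeEnd_apply_map h, B.edgeEnd_apply_map h, projEnd_apply, if_pos h]
    · push Not at h
      rw [B.edgeEnd_apply_eq_zero h, B.edgeEnd_apply_eq_zero h]
  | range_mul_ghost e =>
    simp only [p, sStar, map_mul, FreeAlgebra.lift_ι_apply, generatorEnd]
    refine LinearMap.ext fun f => funext fun y => ?_
    rw [Module.End.mul_apply, projEnd_apply, ghostEnd_apply]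
    split_ifs <;> rfl
  | ghost_mul_source e =>
    simp only [p, sStar, map_mul, FreeAlgebra.lift_ι_apply, generatorEnd]
    refine LinearMap.ext fun f => funext fun y => ?_
    rw [Module.End.mul_apply, ghostEnd_apply, ghostEnd_apply, projEnd_apply]
    split_ifs with h1 h2
    exacts [rfl, absurd (B.map_mem h1) h2, rfl]
  | ghost_mul_edge_self e =>
    simp only [p, s, sStar, map_mul, FreeAlgebra.lift_ι_apply, generatorEnd]
    refine LinearMap.ext fun f => funext fun y => ?_
    rw [Module.End.mul_apply, ghostEnd_apply, projEnd_apply]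
    split_ifs with h
    exacts [B.edgeEnd_apply_map h f, rfl]
  | ghost_mul_edge_of_ne hef =>
    simp only [s, sStar, map_mul, FreeAlgebra.lift_ι_apply, generatorEnd, map_zero]
    refine LinearMap.ext fun f => funext fun y => ?_
    rw [Module.End.mul_apply, ghostEnd_apply]
    split_ifs with h
    · exact B.edgeEnd_apply_eq_zero (fun y' hy' h' => hef (B.eq_of_map_eq hy' h h').1.symm) f
    · rfl
  | regular v hv =>
    simp only [p, s, sStar, map_sum, map_mul, FreeAlgebra.lift_ι_apply, generatorEnd]
    refine LinearMap.ext fun f => funext fun y => ?_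
    rw [LinearMap.sum_apply, Finset.sum_apply, projEnd_apply]
    simp only [Module.End.mul_apply]
    split_ifs with hy
    -- The images cover `D_v` and are disjoint, so exactly one edge contributes at `y`.
    · obtain ⟨e, he, y', hy', rfl⟩ := B.exists_map_eq hv hy
      rw [Finset.sum_eq_single_of_mem e (hv.2.mem_toFinset.2 he), B.edgeEnd_apply_map hy',
        ghostEnd_apply, if_pos hy']
      exact fun e' _ he' => B.edgeEnd_apply_eq_zero
        (fun z hz h => he' (B.eq_of_map_eq hz hy' h).1) _
    · refine (Finset.sum_eq_zero fun e he => B.edgeEnd_apply_eq_zero ?_ _).symm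
      rintro y' h rfl
      obtain rfl : G.source e = v := hv.2.mem_toFinset.1 he
      exact hy (B.map_mem h)

variable (K) in
/-- The representation of the Leavitt path algebra on functions. -/
noncomputable def representation : RingQuot (G.LeavittRel K) →ₐ[K] Module.End K (Y → K) :=
  RingQuot.liftAlgHom K ⟨FreeAlgebra.lift K (B.generatorEnd K), fun _ _ => B.lift_eq_of_leavittRel⟩

theorem representation_proj {A : Set V} (hA : G.IsGeneralizedVertex A) :
    B.representation K (RingQuot.mkAlgHom K (G.LeavittRel K) (G.p K hA)) = B.projEnd K A := by
  rw [representation, RingQuot.liftAlgHom_mkAlgHom_apply, p, FreeAlgebra.lift_ι_apply]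
  rfl

theorem projEnd_eq_zero_iff {A : Set V} : B.projEnd K A = 0 ↔ B.set A = ∅ := by
  constructor
  · intro h
    refine Set.eq_empty_of_forall_notMem fun y hy => ?_
    have := congrFun (LinearMap.congr_fun h 1) y
    rw [projEnd_apply, if_pos hy] at this
    exact one_ne_zero this
  · intro h
    refine LinearMap.ext fun f => funext fun y => ?_
    rw [projEnd_apply, h]
    exact if_neg (Set.notMem_empty y)

end BranchingSystem

/-! ### The branching system of ultrafilters avoiding `H` -/

variable {G} {H : Set (Set V)}

/-- The sets `A \ B` with `B ∈ H` form a filter base because `H` is closed under unions, and none is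
empty because `A ⊆ B` would put `A` in `H`. Any ultrafilter refining this filter works. -/
theorem IsHereditary.exists_ultrafilter (hH : G.IsHereditary H) (hne : H.Nonempty) {A : Set V}
    (hA : G.IsGeneralizedVertex A) (hAH : A ∉ H) :
    ∃ U : Ultrafilter V, A ∈ U ∧ ∀ B ∈ H, B ∉ U := by
  let f : Filter V :=
    { sets := {s | ∃ B ∈ H, A \ B ⊆ s}
      univ_sets := let ⟨B, hB⟩ := hne; ⟨B, hB, Set.subset_univ _⟩
      sets_of_superset := fun ⟨B, hB, h⟩ h' => ⟨B, hB, h.trans h'⟩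
      inter_sets := by
        rintro s t ⟨B, hB, h⟩ ⟨B', hB', h'⟩
        refine ⟨B ∪ B', hH.union_mem B hB B' hB', fun v hv => ⟨h ⟨hv.1, ?_⟩, h' ⟨hv.1, ?_⟩⟩⟩
        exacts [fun h => hv.2 (Or.inl h), fun h => hv.2 (Or.inr h)] }
  have hf : f.NeBot := by
    refine Filter.neBot_iff.2 fun h => ?_
    have : ∅ ∈ f := Filter.empty_mem_iff_bot.2 h
    obtain ⟨B, hB, h⟩ := this
    exact hAH (hH.mem_of_subset B hB A hA (Set.sdiff_eq_empty.1 (Set.subset_empty_iff.1 h)))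
  obtain ⟨U, hU⟩ := Ultrafilter.exists_le f
  refine ⟨U, hU (let ⟨B, hB⟩ := hne; ⟨B, hB, Set.sdiff_subset⟩), fun B hB hBU => ?_⟩
  exact Ultrafilter.compl_mem_iff_notMem.1 (hU ⟨B, hB, fun v hv => hv.2⟩) hBU

theorem nonempty_equiv_of_prod_embedding {α κ Z : Type*} [Infinite κ] (hα : Nonempty (α ↪ κ))
    (hZ : Nonempty (Z ↪ α × κ)) (hκ : Nonempty (κ ↪ Z)) : Nonempty (Z ≃ κ) := by
  have hκκ : Nonempty (κ × κ ≃ κ) := by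
    rw [← Cardinal.eq, Cardinal.mk_prod, Cardinal.lift_id,
      Cardinal.mul_eq_self (Cardinal.aleph0_le_mk κ)]
  exact Function.Embedding.antisymm
    (hZ.some.trans ((hα.some.prodMap (Function.Embedding.refl κ)).trans hκκ.some.toEmbedding))
    hκ.some

/-- Points are ultrafilters avoiding `H`, each repeated `κ` times, and `D_A` consists of those
containing `A`. Thus `D_{v}` is one fibre, over the principal ultrafilter at `v`, or empty. When the
domains of the maps of edges leaving `v` are not all empty, their disjoint union has the cardinality
of `κ` and can be matched bijectively with that fibre. -/
theorem exists_branchingSystem.{u, v} {V : Type u} {E : Type v} {G : Ultragraph V E}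
    {H : Set (Set V)} (hH : G.IsHereditary H) (hs : G.IsSaturated H) (hne : H.Nonempty) :
    ∃ (Y : Type (max u v)) (B : G.BranchingSystem Y),
      ∀ A, G.IsGeneralizedVertex A → (B.set A = ∅ ↔ A ∈ H) := by
  classical
  let X := {U : Ultrafilter V // ∀ A ∈ H, A ∉ U}
  -- Infinite because of `ℕ`, and large enough to absorb `E × X`.
  let κ := (X × E) ⊕ X ⊕ E ⊕ ℕ
  -- The disjoint union of the sets `D_{r(e)}` over the edges `e` leaving `v`.
  let Z : V → Type _ := fun v =>
    {z : (E × X) × κ // G.source z.1.1 = v ∧ G.range z.1.1 ∈ z.1.2.1}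
  have hZ : ∀ v, Nonempty (Z v) → Nonempty (Z v ≃ κ) := by
    rintro v ⟨⟨⟨⟨e, x⟩, k⟩, h⟩⟩
    refine nonempty_equiv_of_prod_embedding (α := E × X) ?_ ⟨Function.Embedding.subtype _⟩ ?_
    · exact ⟨(Equiv.prodComm E X).toEmbedding.trans Function.Embedding.inl⟩
    · exact ⟨fun k => ⟨((e, x), k), h⟩, fun k k' h => by simpa using congrArg (fun z => z.1.2) h⟩
  have hpure : ∀ e, ∀ x : X, G.range e ∈ x.1 → ∀ A ∈ H, A ∉ (pure (G.source e) : Ultrafilter V) := by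
    intro e x hx A hA h
    rw [Ultrafilter.mem_pure] at h
    exact x.2 _ (hH.range_mem e (hH.mem_of_subset A hA _ (.singleton _)
      (Set.singleton_subset_iff.2 h))) hx
  let θ : ∀ v, Nonempty (Z v) → (Z v ≃ κ) := fun v h => (hZ v h).some
  let map : E → X × κ → X × κ := fun e y =>
    if h : G.range e ∈ y.1.1 then
      (⟨pure (G.source e), hpure e y.1 h⟩, θ (G.source e) ⟨⟨((e, y.1), y.2), rfl, h⟩⟩
        ⟨((e, y.1), y.2), rfl, h⟩)
    else y
  refine ⟨X × κ, ⟨fun A => {y | A ∈ y.1.1}, map, ?_, ?_, ?_, ?_, ?_, ?_⟩, ?_⟩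
  · ext y
    simp
  · intro A A'
    ext y
    exact Filter.inter_mem_iff
  · intro A A'
    ext y
    exact Ultrafilter.union_mem_iff
  · intro e y hy
    have hy' : G.range e ∈ y.1.1 := hy
    simp only [map, dif_pos hy', Set.mem_ofPred_eq]
    exact Ultrafilter.mem_pure.2 rfl
  · intro e e' y y' hy hy' h
    have hy1 : G.range e ∈ y.1.1 := hy
    have hy1' : G.range e' ∈ y'.1.1 := hy'
    simp only [map, dif_pos hy1, dif_pos hy1'] at h
    obtain ⟨h1, h2⟩ := Prod.mk.inj h
    have h3 : G.source e = G.source e' := Ultrafilter.pure_injective (congrArg Subtype.val h1)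
    -- The sources agree only propositionally, so injectivity of `θ` is stated across an equality of
    -- vertices.
    have key : ∀ v w (hvw : v = w) (a : Z v) (b : Z w) (ha : Nonempty (Z v)) (hb : Nonempty (Z w)),
        θ v ha a = θ w hb b → a.1 = b.1 := by
      rintro v _ rfl a b ha hb hab
      exact congrArg Subtype.val ((θ v ha).injective hab)
    have h4 := key _ _ h3 _ _ ⟨⟨((e, y.1), y.2), rfl, hy1⟩⟩ ⟨⟨((e', y'.1), y'.2), rfl, hy1'⟩⟩ h2
    simp only [Prod.mk.injEq] at h4
    exact ⟨h4.1.1, Prod.ext h4.1.2 h4.2⟩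
  · rintro v ⟨x, k⟩ hv hy
    have hvx : {v} ∈ x.1 := hy
    have hx : x.1 = pure v := by
      obtain ⟨w, hw, h⟩ := Ultrafilter.eq_pure_of_finite_mem (Set.finite_singleton v) hvx
      rwa [Set.mem_singleton_iff.1 hw] at h
    have hvH : {v} ∉ H := fun h => x.2 _ h hvx
    -- Saturation supplies an edge with range outside `H`; an ultrafilter containing that range
    -- shows that `Z v` is nonempty, and surjectivity of `θ` gives the covering.
    obtain ⟨e, he, heH⟩ : ∃ e, G.source e = v ∧ G.range e ∉ H := by
      by_contra! h
      refine hvH (hs v hv ?_)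
      rintro _ ⟨e, he, rfl⟩
      exact h e he
    obtain ⟨U, hU, hUH⟩ := hH.exists_ultrafilter hne (.range e) heH
    have hne : Nonempty (Z v) := ⟨⟨((e, ⟨U, hUH⟩), k), he, hU⟩⟩
    obtain ⟨⟨⟨⟨e', x'⟩, k'⟩, h1, h2⟩, hz⟩ := (θ v hne).surjective k
    refine ⟨e', h1, (x', k'), h2, ?_⟩
    have h2' : G.range e' ∈ x'.1 := h2
    simp only [map, dif_pos h2']
    obtain rfl : G.source e' = v := h1
    exact Prod.ext (Subtype.ext hx.symm) hz
  · intro A hA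
    constructor
    · intro h
      by_contra hAH
      obtain ⟨U, hU, hUH⟩ := hH.exists_ultrafilter hne hA hAH
      exact Set.eq_empty_iff_forall_notMem.1 h (⟨U, hUH⟩, Sum.inr (Sum.inr (Sum.inr 0))) hU
    · exact fun h => Set.eq_empty_of_forall_notMem fun y hy => y.1.2 A h hy

/-! ### Idempotent ideals of ultragraph algebras -/

section Ideals

variable (K : Type*) [Field K]

variable (G) in
/-- The generator `p_A` of the Leavitt path algebra. -/
def leavittProj {A : Set V} (hA : G.IsGeneralizedVertex A) : G.LeavittPathAlgebra K :=
  PresentedAlgebra.of K (G.LeavittRel K) (.proj A hA)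

theorem leavittProj_mul_self {A : Set V} (hA : G.IsGeneralizedVertex A) :
    G.leavittProj K hA * G.leavittProj K hA = G.leavittProj K hA := by
  have h := RingQuot.mkAlgHom_rel K (LeavittRel.proj_mul (K := K) hA hA)
  have h' : ∀ {B : Set V} (hB : G.IsGeneralizedVertex B), B = A → G.p K hB = G.p K hA := by
    rintro _ _ rfl
    rfl
  rw [map_mul, h' _ (Set.inter_self A)] at h
  exact Subtype.ext h

variable (G) in
/-- The ideal of the Leavitt path algebra generated by the `p_A` for `A` in a family of sets. -/
def leavittIdeal (H : Set (Set V)) : TwoSidedIdeal (G.LeavittPathAlgebra K) :=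
  .span {x | ∃ (A : Set V) (hA : G.IsGeneralizedVertex A), A ∈ H ∧ G.leavittProj K hA = x}

theorem isIdempotent_leavittIdeal (H : Set (Set V)) : (G.leavittIdeal K H).IsIdempotent := by
  refine TwoSidedIdeal.isIdempotent_span ?_
  rintro _ ⟨A, hA, -, rfl⟩
  exact leavittProj_mul_self K hA

/-- The kernel of the representation contains the ideal, and it contains `p_A` only when `D_A` is
empty. -/
theorem leavittProj_mem_leavittIdeal_iff (hH : G.IsHereditary H) (hs : G.IsSaturated H)
    (hne : H.Nonempty) {A : Set V} (hA : G.IsGeneralizedVertex A) :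
    G.leavittProj K hA ∈ G.leavittIdeal K H ↔ A ∈ H := by
  refine ⟨fun h => ?_, fun h => TwoSidedIdeal.subset_span ⟨A, hA, h, rfl⟩⟩
  obtain ⟨Y, B, hB⟩ := exists_branchingSystem hH hs hne
  let φ := (B.representation K).toRingHom.toNonUnitalRingHom.comp
    (NonUnitalSubringClass.subtype (G.LeavittPathAlgebra K))
  have hφ : ∀ {C : Set V} (hC : G.IsGeneralizedVertex C),
      G.leavittProj K hC ∈ TwoSidedIdeal.ker φ ↔ C ∈ H := by
    intro C hC
    rw [TwoSidedIdeal.mem_ker, ← hB C hC, ← B.projEnd_eq_zero_iff (K := K),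
      ← B.representation_proj hC]
    rfl
  have hle : G.leavittIdeal K H ≤ TwoSidedIdeal.ker φ := by
    refine TwoSidedIdeal.span_le.2 ?_
    rintro _ ⟨C, hC, hCH, rfl⟩
    exact (hφ hC).2 hCH
  exact (hφ hA).1 (hle h)

theorem infinite_isIdempotent_leavittPathAlgebra
    (hinf : {H : Set (Set V) | G.IsHereditary H ∧ G.IsSaturated H}.Infinite) :
    {I : TwoSidedIdeal (G.LeavittPathAlgebra K) | I.IsIdempotent}.Infinite := by
  -- The empty family is discarded: it is formally hereditary and saturated, but yields the zero
  -- ideal just as `{∅}` does.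
  refine Set.infinite_of_injOn_mapsTo (f := G.leavittIdeal K) ?_
    (fun H _ => isIdempotent_leavittIdeal K H) (hinf.sdiff (Set.finite_singleton ∅))
  have key : ∀ H₁ H₂ : Set (Set V), G.IsHereditary H₁ → G.IsSaturated H₁ → H₁.Nonempty →
      G.IsHereditary H₂ → G.IsSaturated H₂ → H₂.Nonempty →
      G.leavittIdeal K H₁ = G.leavittIdeal K H₂ → H₁ ⊆ H₂ := by
    intro H₁ H₂ h₁ s₁ n₁ h₂ s₂ n₂ h A hA
    have hG : G.IsGeneralizedVertex A := h₁.subset hA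
    rwa [← leavittProj_mem_leavittIdeal_iff K h₂ s₂ n₂ hG, ← h,
      leavittProj_mem_leavittIdeal_iff K h₁ s₁ n₁ hG]
  rintro H₁ ⟨⟨h₁, s₁⟩, n₁⟩ H₂ ⟨⟨h₂, s₂⟩, n₂⟩ h
  have n₁' := Set.nonempty_iff_ne_empty.2 n₁
  have n₂' := Set.nonempty_iff_ne_empty.2 n₂
  exact (key _ _ h₁ s₁ n₁' h₂ s₂ n₂' h).antisymm (key _ _ h₂ s₂ n₂' h₁ s₁ n₁' h.symm)

end Ideals

end Ultragraph

theorem mainTheorem12 {V E : Type*} [Countable V] [Countable E] (G : Ultragraph V E)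
    (K : Type*) [Field K]
    (hunital : ∃ u : G.LeavittPathAlgebra K, ∀ x : G.LeavittPathAlgebra K, u * x = x ∧ x * u = x)
    (hinf : {H : Set (Set V) | G.IsHereditary H ∧ G.IsSaturated H}.Infinite)
    (F : Type*) [Field F] (W : Type*) [Quiver W] :
    IsEmpty (G.LeavittPathAlgebra K ≃+* Quiver.LeavittPathAlgebra W F) := by
  refine ⟨fun φ => ?_⟩
  obtain ⟨u, hu⟩ := hunital
  have hu' : ∀ x : Quiver.LeavittPathAlgebra W F, φ u * x = x ∧ x * φ u = x := by
    intro x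
    obtain ⟨x, rfl⟩ := φ.surjective x
    rw [← map_mul, ← map_mul, (hu x).1, (hu x).2]
    exact ⟨rfl, rfl⟩
  exact Ultragraph.infinite_isIdempotent_leavittPathAlgebra K hinf
    (TwoSidedIdeal.finite_isIdempotent_of_ringEquiv φ
      (Quiver.finite_isIdempotent_leavittPathAlgebra hu'))
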